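/- Let $G$ be a compact Hausdorff group with normalized Haar measure $m_G$, let $\Phi:[0,\infty)\to[0,\infty)$ be a (finite-valued) Young function satisfying the $\Delta_2$-condition, and let $L^\Phi(G)$ be the Orlicz space of complex functions with the Luxemburg norm $\|f\|_\Phi=\inf\{k>0:\int_G\Phi(|f|/k)\,dm_G\le 1\}$. Put $\Phi^{-1}(1)=\sup\{x\ge 0:\Phi(x)\le 1\}$. Let $\mu$ be a bounded complex Radon measure on $G$ with $\mu(G)\neq 0$, and let $\nu=\nu_{\Phi,\mu}$ be the $L^\Phi(G)$-valued vector measure $\nu(A)=\mu*\chi_A$ on the Borel sets of $G$, where $(\mu*f)(t)=\int_G f(s^{-1}t)\,d\mu(s)$. For $x'$ in the dual of $L^\Phi(G)$ write $\langle\nu,x'\rangle(A)=\langle \nu(A),x'\rangle$, and let $\|\nu\|=\sup_{\|x'\|\le1}|\langle\nu,x'\rangle|(G)$ be the total semivariation. Let $L^1(\nu)$ be the space of (classes of) Borel functions $f:G\to\mathbb{C}$ that are integrable with respect to all $|\langle\nu,x'\rangle|$ and such that for each Borel set $A$ there is a unique vector $x_A\in L^\Phi(G)$ with $\int_A f\,d\langle\nu,x'\rangle=\langle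 x_A,x'\rangle$ for all $x'$; it carries the norm $\|f\|_\nu=\sup_{\|x'\|\le 1}\int_G|f|\,d|\langle\nu,x'\rangle|$. Then $0<\|\nu\|<\infty$ and: (i) If $f\in L^1(\nu)$, then $f\in L^1(G)$ and $\displaystyle\|f\|_1\le\frac{\Phi^{-1}(1)}{|\mu(G)|}\,\|f\|_\nu$. (ii) The inclusion $\jmath:L^1(\nu)\to L^1(G)$ is a well-defined injective continuous linear map, with $\displaystyle\frac{1}{\|\nu\|}\le\|\jmath\|\le\frac{\Phi^{-1}(1)}{|\mu(G)|}$. (iii) The range of $\jmath$ is a dense linear subspace of $L^1(G)$ that is invariant under all right translations $f\mapsto f(\,\cdot\,t)$, $t\in G$. -/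

import Mathlib

open MeasureTheory Filter Topology Set
open scoped NNReal ENNReal

/-- A (finite-valued) Young function: a convex function `Φ : [0, ∞) → [0, ∞)` with `Φ 0 = 0` and
`Φ x → ∞` as `x → ∞`. -/
structure YoungFunction where
  toFun : ℝ≥0 → ℝ≥0
  convexOn' : ConvexOn ℝ≥0 univ toFun
  map_zero' : toFun 0 = 0
  tendsto_atTop' : Tendsto toFun atTop atTop

namespace YoungFunction

instance : CoeFun YoungFunction (fun _ => ℝ≥0 → ℝ≥0) := ⟨YoungFunction.toFun⟩

/-- The `Δ₂`-condition: `Φ (2 x) ≤ K Φ x` for all `x ≥ x₀`. -/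
def DeltaTwo (Φ : YoungFunction) : Prop :=
  ∃ K : ℝ≥0, 0 < K ∧ ∃ x₀ : ℝ≥0, 0 < x₀ ∧ ∀ x, x₀ ≤ x → Φ (2 * x) ≤ K * Φ x

/-- The inverse `Φ⁻¹ a = sup {x | Φ x ≤ a}` of a Young function. -/
noncomputable def inv (Φ : YoungFunction) (a : ℝ≥0) : ℝ≥0 := sSup {x | Φ x ≤ a}

theorem map_mul_le (Φ : YoungFunction) {t : ℝ≥0} (ht : t ≤ 1) (x : ℝ≥0) :
    Φ (t * x) ≤ t * Φ x := by
  have h := Φ.convexOn'.2 (mem_univ x) (mem_univ 0) zero_le zero_le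
    (add_tsub_cancel_of_le ht)
  simpa [Φ.map_zero'] using h

theorem mono (Φ : YoungFunction) : Monotone Φ := by
  intro x y hxy
  rcases eq_or_ne y 0 with rfl | hy
  · rw [nonpos_iff_eq_zero.1 hxy]
  have ht : x / y ≤ 1 := div_le_one_of_le₀ hxy zero_le
  have h := Φ.map_mul_le ht y
  rw [div_mul_cancel₀ x hy] at h
  exact h.trans (mul_le_of_le_one_left zero_le ht)

theorem tendsto_zero (Φ : YoungFunction) : Tendsto Φ (𝓝 0) (𝓝 0) := by
  have h1 : Tendsto (fun x : ℝ≥0 => x * Φ 1) (𝓝 0) (𝓝 0) := by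
    simpa using (tendsto_id (x := 𝓝 (0 : ℝ≥0))).mul_const (Φ 1)
  refine tendsto_of_tendsto_of_tendsto_of_le_of_le' tendsto_const_nhds h1
    (Eventually.of_forall fun x => zero_le) ?_
  filter_upwards [ge_mem_nhds (zero_lt_one (α := ℝ≥0))] with x hx
  simpa using Φ.map_mul_le hx 1

theorem measurable (Φ : YoungFunction) : Measurable Φ := Φ.mono.measurable

end YoungFunction

section Orlicz

variable {α : Type*} {mα : MeasurableSpace α}

/-- The modular `∫ Φ (|f| / k) dm`. -/
noncomputable def orliczModular (Φ : YoungFunction) (m : Measure α) (f : α →ₘ[m] ℂ) (k : ℝ≥0) :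
    ℝ≥0∞ :=
  ∫⁻ x, (Φ (‖f x‖₊ / k) : ℝ≥0∞) ∂m

/-- The Luxemburg norm `inf {k > 0 | ∫ Φ (|f| / k) dm ≤ 1}`
(meaningful when there is such a `k`). -/
noncomputable def luxemburg (Φ : YoungFunction) (m : Measure α) (f : α →ₘ[m] ℂ) : ℝ≥0 :=
  sInf {k : ℝ≥0 | 0 < k ∧ orliczModular Φ m f k ≤ 1}

variable {Φ : YoungFunction} {m : Measure α}

theorem orliczModular_anti (f : α →ₘ[m] ℂ) {k l : ℝ≥0} (hk : 0 < k) (h : k ≤ l) :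
    orliczModular Φ m f l ≤ orliczModular Φ m f k := by
  refine lintegral_mono fun x => ?_
  exact ENNReal.coe_le_coe.2 (Φ.mono (by gcongr))

theorem orliczModular_add (f g : α →ₘ[m] ℂ) {a b : ℝ≥0} (ha : 0 < a) (hb : 0 < b)
    (hf : orliczModular Φ m f a ≤ 1) (hg : orliczModular Φ m g b ≤ 1) :
    orliczModular Φ m (f + g) (a + b) ≤ 1 := by
  have hab : a + b ≠ 0 := (add_pos ha hb).ne'
  have hsum : a / (a + b) + b / (a + b) = 1 := by rw [← add_div, div_self hab]
  have hpt : ∀ᵐ x ∂m, (Φ (‖(f + g) x‖₊ / (a + b)) : ℝ≥0∞) ≤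
      (a / (a + b) : ℝ≥0) * (Φ (‖f x‖₊ / a) : ℝ≥0∞) +
        (b / (a + b) : ℝ≥0) * (Φ (‖g x‖₊ / b) : ℝ≥0∞) := by
    filter_upwards [AEEqFun.coeFn_add f g] with x hx
    rw [hx, Pi.add_apply]
    have h1 : ‖f x + g x‖₊ / (a + b) ≤
        (a / (a + b)) • (‖f x‖₊ / a) + (b / (a + b)) • (‖g x‖₊ / b) := by
      have : (a / (a + b)) • (‖f x‖₊ / a) + (b / (a + b)) • (‖g x‖₊ / b)
          = (‖f x‖₊ + ‖g x‖₊) / (a + b) := by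
        simp only [smul_eq_mul]
        field_simp
      rw [this]
      gcongr
      exact nnnorm_add_le _ _
    have h2 := Φ.convexOn'.2 (mem_univ (‖f x‖₊ / a)) (mem_univ (‖g x‖₊ / b))
      zero_le zero_le hsum
    exact_mod_cast (Φ.mono h1).trans h2
  have hfm : AEMeasurable (fun x => (Φ (‖f x‖₊ / a) : ℝ≥0∞)) m :=
    (Φ.measurable.comp_aemeasurable
      (f.aestronglyMeasurable.aemeasurable.nnnorm.div_const a)).coe_nnreal_ennreal
  calc orliczModular Φ m (f + g) (a + b)
      ≤ ∫⁻ x, ((a / (a + b) : ℝ≥0) * (Φ (‖f x‖₊ / a) : ℝ≥0∞) +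
        (b / (a + b) : ℝ≥0) * (Φ (‖g x‖₊ / b) : ℝ≥0∞)) ∂m := lintegral_mono_ae hpt
    _ = (a / (a + b) : ℝ≥0) * orliczModular Φ m f a +
        (b / (a + b) : ℝ≥0) * orliczModular Φ m g b := by
        rw [lintegral_add_left' (hfm.const_mul _), lintegral_const_mul' _ _ ENNReal.coe_ne_top,
          lintegral_const_mul' _ _ ENNReal.coe_ne_top]
        rfl
    _ ≤ (a / (a + b) : ℝ≥0) * 1 + (b / (a + b) : ℝ≥0) * 1 := by gcongr
    _ = 1 := by rw [mul_one, mul_one, ← ENNReal.coe_add, hsum, ENNReal.coe_one]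

theorem orliczModular_smul {c : ℂ} (hc : c ≠ 0) (f : α →ₘ[m] ℂ) (k : ℝ≥0) :
    orliczModular Φ m (c • f) (‖c‖₊ * k) = orliczModular Φ m f k := by
  refine lintegral_congr_ae ?_
  filter_upwards [AEEqFun.coeFn_smul c f] with x hx
  rw [hx, Pi.smul_apply, nnnorm_smul, mul_div_mul_left _ _ (nnnorm_ne_zero_iff.2 hc)]

theorem orliczModular_zero (k : ℝ≥0) : orliczModular Φ m (0 : α →ₘ[m] ℂ) k = 0 := by
  have : (fun x => (Φ (‖(0 : α →ₘ[m] ℂ) x‖₊ / k) : ℝ≥0∞)) =ᵐ[m] fun _ => 0 := by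
    filter_upwards [AEEqFun.coeFn_zero (α := α) (β := ℂ) (μ := m)] with x hx
    simp [hx, Φ.map_zero']
  rw [orliczModular, lintegral_congr_ae this, lintegral_zero]

variable (Φ m) in
/-- The Orlicz space `L^Φ(m)`: classes of measurable functions with
`∫ Φ (|f| / k) dm ≤ 1` for some `k > 0`, i.e. with finite Luxemburg norm. -/
noncomputable def OrliczSpace : Submodule ℂ (α →ₘ[m] ℂ) where
  carrier := {f | ∃ k : ℝ≥0, 0 < k ∧ orliczModular Φ m f k ≤ 1}
  zero_mem' := ⟨1, one_pos, by rw [orliczModular_zero]; exact zero_le_one⟩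
  add_mem' := by
    rintro f g ⟨a, ha, hfa⟩ ⟨b, hb, hgb⟩
    exact ⟨a + b, add_pos ha hb, orliczModular_add f g ha hb hfa hgb⟩
  smul_mem' := by
    rintro c f ⟨a, ha, hfa⟩
    rcases eq_or_ne c 0 with rfl | hc
    · exact ⟨1, one_pos, by rw [zero_smul, orliczModular_zero]; exact zero_le_one⟩
    · exact ⟨‖c‖₊ * a, mul_pos (nnnorm_pos.2 hc) ha, by rwa [orliczModular_smul hc]⟩

noncomputable instance : Norm (OrliczSpace Φ m) := ⟨fun f => (luxemburg Φ m f.1 : ℝ)⟩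

theorem OrliczSpace.norm_def (f : OrliczSpace Φ m) : ‖f‖ = (luxemburg Φ m f.1 : ℝ) := rfl

theorem luxemburg_le {f : α →ₘ[m] ℂ} {k : ℝ≥0} (hk : 0 < k) (h : orliczModular Φ m f k ≤ 1) :
    luxemburg Φ m f ≤ k := csInf_le (OrderBot.bddBelow _) ⟨hk, h⟩

theorem orliczModular_le_one_of_lt {f : α →ₘ[m] ℂ} (hf : f ∈ OrliczSpace Φ m) {k : ℝ≥0}
    (h : luxemburg Φ m f < k) : orliczModular Φ m f k ≤ 1 := by
  obtain ⟨l, ⟨hl, hl'⟩, hlk⟩ := exists_lt_of_csInf_lt hf h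
  exact (orliczModular_anti f hl hlk.le).trans hl'

theorem luxemburg_smul_le (c : ℂ) {f : α →ₘ[m] ℂ} (hf : f ∈ OrliczSpace Φ m) :
    luxemburg Φ m (c • f) ≤ ‖c‖₊ * luxemburg Φ m f := by
  rcases eq_or_ne c 0 with rfl | hc
  · rw [show (0 : ℂ) • f = 0 from zero_smul ℂ f, nnnorm_zero, zero_mul]
    refine le_of_forall_gt fun k hk => ?_
    obtain ⟨l, hl, hlk⟩ := exists_between hk
    exact (luxemburg_le hl (by rw [orliczModular_zero]; exact zero_le_one)).trans_lt hlk
  · have hc' : ‖c‖₊ ≠ 0 := nnnorm_ne_zero_iff.2 hc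
    have : ‖c‖₊⁻¹ * luxemburg Φ m (c • f) ≤ luxemburg Φ m f := by
      refine le_of_forall_gt_imp_ge_of_dense fun k hk => ?_
      have h1 := orliczModular_le_one_of_lt hf hk
      have h2 := luxemburg_le (mul_pos (pos_iff_ne_zero.2 hc') (zero_le.trans_lt hk))
        ((orliczModular_smul hc f k).le.trans h1)
      calc ‖c‖₊⁻¹ * luxemburg Φ m (c • f) ≤ ‖c‖₊⁻¹ * (‖c‖₊ * k) := by gcongr
        _ = k := by rw [inv_mul_cancel_left₀ hc']
    calc luxemburg Φ m (c • f) = ‖c‖₊ * (‖c‖₊⁻¹ * luxemburg Φ m (c • f)) := by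
          rw [mul_inv_cancel_left₀ hc']
      _ ≤ _ := by gcongr

theorem ae_eq_zero_of_luxemburg_eq_zero {f : α →ₘ[m] ℂ} (hf : f ∈ OrliczSpace Φ m)
    (h : luxemburg Φ m f = 0) : f = 0 := by
  have key : ∀ δ : ℝ≥0, 0 < δ → m {x | δ ≤ ‖f x‖₊} = 0 := by
    intro δ hδ
    by_contra hne
    have hN : ∀ N : ℝ≥0, (N : ℝ≥0∞) * m {x | δ ≤ ‖f x‖₊} ≤ 1 := by
      intro N
      obtain ⟨y, hy⟩ := ((tendsto_atTop.1 Φ.tendsto_atTop' N).and (eventually_gt_atTop 0)).exists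
      have hk : 0 < δ / y := div_pos hδ hy.2
      have h1 := orliczModular_le_one_of_lt hf (h ▸ hk)
      refine le_trans ?_ h1
      have hm : AEMeasurable (fun x => (Φ (‖f x‖₊ / (δ / y)) : ℝ≥0∞)) m :=
        (Φ.measurable.comp_aemeasurable
          (f.aestronglyMeasurable.aemeasurable.nnnorm.div_const _)).coe_nnreal_ennreal
      refine le_trans ?_ (mul_meas_ge_le_lintegral₀ hm (N : ℝ≥0∞))
      gcongr
      intro hx
      refine ENNReal.coe_le_coe.2 (hy.1.trans (Φ.mono ?_))
      rw [le_div_iff₀ hk]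
      calc y * (δ / y) = δ := by field_simp [hy.2.ne']
        _ ≤ _ := hx
    have htop : (∞ : ℝ≥0∞) * m {x | δ ≤ ‖f x‖₊} ≤ 1 := by
      rw [← ENNReal.iSup_natCast, ENNReal.iSup_mul]
      exact iSup_le fun n => by simpa using hN n
    rw [ENNReal.top_mul hne] at htop
    exact absurd htop (by simp)
  refine AEEqFun.ext ?_
  have hall : ∀ᵐ x ∂m, ∀ n : ℕ, ‖f x‖₊ < 1 / ((n : ℝ≥0) + 1) := by
    rw [ae_all_iff]
    intro n
    have := key (1 / ((n : ℝ≥0) + 1)) (by positivity)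
    rw [ae_iff]
    simpa only [not_lt] using this
  filter_upwards [hall, AEEqFun.coeFn_zero (α := α) (β := ℂ) (μ := m)] with x hx hx0
  rw [hx0, Pi.zero_apply, ← nnnorm_eq_zero]
  by_contra hne
  obtain ⟨n, hn⟩ := exists_nat_one_div_lt (K := ℝ≥0) (pos_iff_ne_zero.2 hne)
  exact absurd (hx n) (not_lt.2 hn.le)

theorem OrliczSpace.core : NormedSpace.Core ℂ (OrliczSpace Φ m) where
  norm_nonneg f := NNReal.coe_nonneg _
  norm_smul c f := by
    refine le_antisymm (by exact_mod_cast luxemburg_smul_le c f.2) ?_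
    rcases eq_or_ne c 0 with rfl | hc
    · rw [norm_zero, zero_mul]; exact NNReal.coe_nonneg _
    have h := luxemburg_smul_le c⁻¹ (c • f).2
    have e : c⁻¹ • (c • f : OrliczSpace Φ m).1 = f.1 := by
      rw [Submodule.coe_smul, inv_smul_smul₀ hc]
    rw [e, nnnorm_inv] at h
    have h' : ‖c‖₊ * luxemburg Φ m f.1 ≤ luxemburg Φ m (c • f : OrliczSpace Φ m).1 := by
      calc ‖c‖₊ * luxemburg Φ m f.1
          ≤ ‖c‖₊ * (‖c‖₊⁻¹ * luxemburg Φ m (c • f : OrliczSpace Φ m).1) := by gcongr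
        _ = _ := mul_inv_cancel_left₀ (nnnorm_ne_zero_iff.2 hc) _
    exact_mod_cast h'
  norm_triangle f g := by
    have : luxemburg Φ m (f.1 + g.1) ≤ luxemburg Φ m f.1 + luxemburg Φ m g.1 := by
      refine le_of_forall_pos_le_add fun ε hε => ?_
      have hε2 : 0 < ε / 2 := half_pos hε
      have h1 := orliczModular_le_one_of_lt f.2 (lt_add_of_pos_right _ hε2)
      have h2 := orliczModular_le_one_of_lt g.2 (lt_add_of_pos_right _ hε2)
      have h3 := luxemburg_le (by positivity)
        (orliczModular_add f.1 g.1 (by positivity) (by positivity) h1 h2)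
      refine h3.trans (le_of_eq ?_)
      rw [add_add_add_comm, add_halves]
    exact_mod_cast this
  norm_eq_zero_iff f := by
    refine ⟨fun h => Subtype.ext (ae_eq_zero_of_luxemburg_eq_zero f.2 ?_), ?_⟩
    · exact NNReal.coe_eq_zero.1 h
    · rintro rfl
      have := luxemburg_smul_le (0 : ℂ) (0 : OrliczSpace Φ m).2
      rw [nnnorm_zero, zero_mul, show (0 : ℂ) • (0 : OrliczSpace Φ m).1 = 0 from zero_smul ℂ (0 : OrliczSpace Φ m).1] at this
      have h0 := le_antisymm this zero_le
      exact NNReal.coe_eq_zero.2 h0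

noncomputable instance : NormedAddCommGroup (OrliczSpace Φ m) :=
  NormedAddCommGroup.ofCore OrliczSpace.core

noncomputable instance : NormedSpace ℂ (OrliczSpace Φ m) :=
  NormedSpace.ofCore OrliczSpace.core

end Orlicz

section VectorMeasureL1

namespace MeasureTheory.VectorMeasure

variable {Ω : Type*} {mΩ : MeasurableSpace Ω} {X : Type*} [NormedAddCommGroup X] [NormedSpace ℂ X]

/-- The complex measure `⟨ν, x'⟩ : A ↦ x' (ν A)`. -/
noncomputable def pair (ν : VectorMeasure Ω X) (x' : StrongDual ℂ X) : ComplexMeasure Ω :=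
  ν.mapRange (x' : X →+ ℂ) x'.continuous

/-- The semivariation `‖ν‖(A) = sup {|⟨ν, x'⟩|(A) | ‖x'‖ ≤ 1}`, over complex functionals. -/
noncomputable def csemivariation (ν : VectorMeasure Ω X) (A : Set Ω) : ℝ≥0∞ :=
  ⨆ x' ∈ {x' : StrongDual ℂ X | ‖x'‖ ≤ 1}, (ν.pair x').variation A

/-- The quantity `sup {∫ |f| d|⟨ν, x'⟩| | ‖x'‖ ≤ 1}`. -/
noncomputable def eL1norm (ν : VectorMeasure Ω X) (f : Ω → ℂ) : ℝ≥0∞ :=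
  ⨆ x' ∈ {x' : StrongDual ℂ X | ‖x'‖ ≤ 1}, ∫⁻ t, ‖f t‖ₑ ∂(ν.pair x').variation

/-- `f` is weakly `ν`-integrable if it lies in `L¹(|⟨ν, x'⟩|)` for every functional `x'`. -/
def IsWeaklyIntegrable (ν : VectorMeasure Ω X) (f : Ω → ℂ) : Prop :=
  Measurable f ∧ ∀ x' : StrongDual ℂ X, MeasureTheory.Integrable f (ν.pair x').variation

/-- `f` is `ν`-integrable if it is weakly `ν`-integrable and for each measurable `A` there is a
unique vector `x_A` (the integral of `f` over `A`) with `∫_A f d⟨ν, x'⟩ = ⟨x_A, x'⟩` for all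
functionals `x'`. -/
def IsIntegrable (ν : VectorMeasure Ω X) (f : Ω → ℂ) : Prop :=
  ν.IsWeaklyIntegrable f ∧ ∀ A, MeasurableSet A → ∃! xA : X, ∀ x' : StrongDual ℂ X,
    ((ν.pair x').restrict A).integral f (ContinuousLinearMap.mul ℝ ℂ) = x' xA

variable {ν : VectorMeasure Ω X} {f g : Ω → ℂ}

theorem existsUnique_of_exists {r : StrongDual ℂ X → ℂ} {x : X} (hx : ∀ x', r x' = x' x) :
    ∃! x : X, ∀ x' : StrongDual ℂ X, r x' = x' x := by
  refine ⟨x, hx, fun y hy => ?_⟩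
  exact (SeparatingDual.eq_iff_forall_dual_eq (R := ℂ)).2 fun x' => (hy x').symm.trans (hx x')

theorem IsWeaklyIntegrable.restrict (hf : ν.IsWeaklyIntegrable f) (x' : StrongDual ℂ X)
    (A : Set Ω) : ((ν.pair x').restrict A).Integrable f :=
  Integrable.restrict (hf.2 x')

theorem cintegral_smul (ρ : ComplexMeasure Ω) (c : ℂ) (f : Ω → ℂ) :
    ρ.integral (c • f) (ContinuousLinearMap.mul ℝ ℂ)
      = c * ρ.integral f (ContinuousLinearMap.mul ℝ ℂ) := by
  rw [integral_eq_setToFun, integral_eq_setToFun, ← smul_eq_mul]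
  refine setToFun_smul _ (fun c s x => ?_) c f
  rw [transpose_eq_cbmApplyMeasure, cbmApplyMeasure_apply, cbmApplyMeasure_apply]
  simp [mul_assoc]

theorem IsIntegrable.zero : ν.IsIntegrable 0 := by
  refine ⟨⟨measurable_const, fun x' => integrable_zero _ _ _⟩, fun A _ => ?_⟩
  exact existsUnique_of_exists (x := 0) fun x' => by
    rw [ContinuousLinearMap.map_zero]
    exact integral_zero

theorem IsIntegrable.add (hf : ν.IsIntegrable f) (hg : ν.IsIntegrable g) :
    ν.IsIntegrable (f + g) := by
  refine ⟨⟨hf.1.1.add hg.1.1, fun x' => (hf.1.2 x').add (hg.1.2 x')⟩, fun A hA => ?_⟩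
  obtain ⟨x, hx, -⟩ := hf.2 A hA
  obtain ⟨y, hy, -⟩ := hg.2 A hA
  refine existsUnique_of_exists (x := x + y) fun x' => ?_
  rw [ContinuousLinearMap.map_add, ← hx, ← hy]
  exact integral_add (hf.1.restrict x' A) (hg.1.restrict x' A)

theorem IsIntegrable.smul (c : ℂ) (hf : ν.IsIntegrable f) : ν.IsIntegrable (c • f) := by
  refine ⟨⟨hf.1.1.const_smul c, fun x' => (hf.1.2 x').smul c⟩, fun A hA => ?_⟩
  obtain ⟨x, hx, -⟩ := hf.2 A hA
  refine existsUnique_of_exists (x := c • x) fun x' => ?_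
  rw [ContinuousLinearMap.map_smul, ← hx, smul_eq_mul]
  exact cintegral_smul _ c f

theorem pair_apply (x' : StrongDual ℂ X) (A : Set Ω) : ν.pair x' A = x' (ν A) := rfl

theorem pair_add (x' y' : StrongDual ℂ X) : ν.pair (x' + y') = ν.pair x' + ν.pair y' := by
  ext A _
  simp [pair_apply]

theorem pair_smul (c : ℂ) (x' : StrongDual ℂ X) : ν.pair (c • x') = c • ν.pair x' := by
  ext A _
  simp [pair_apply]

theorem lowerSemicontinuous_variation_pair {E : Set Ω} (hE : MeasurableSet E) :
    LowerSemicontinuous fun x' : StrongDual ℂ X => (ν.pair x').variation E := by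
  intro x' c hc
  obtain ⟨P, hP1, hP2, -, hP4⟩ := exists_lt_sum_of_lt_variation (ν.pair x') hE hc
  have hcont : Continuous fun y' : StrongDual ℂ X => ∑ p ∈ P, ‖ν.pair y' p‖ₑ := by
    refine continuous_finsetSum _ fun p _ => ?_
    simp only [pair_apply]
    exact continuous_enorm.comp (ContinuousLinearMap.apply ℂ ℂ (ν p)).continuous
  filter_upwards [hcont.continuousAt.eventually_const_lt hP4] with y' hy'
  exact hy'.trans_le (le_variation _ hE hP1 hP2)

theorem lowerSemicontinuous_lintegral_pair (hf : Measurable f) :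
    LowerSemicontinuous fun x' : StrongDual ℂ X => ∫⁻ t, ‖f t‖ₑ ∂(ν.pair x').variation := by
  have : (fun x' : StrongDual ℂ X => ∫⁻ t, ‖f t‖ₑ ∂(ν.pair x').variation) = fun x' =>
      ⨆ n, (SimpleFunc.eapprox (fun t => ‖f t‖ₑ) n).lintegral (ν.pair x').variation := by
    ext x'
    exact lintegral_eq_iSup_eapprox_lintegral hf.enorm
  rw [this]
  refine lowerSemicontinuous_iSup fun n => ?_
  simp only [SimpleFunc.lintegral]
  refine lowerSemicontinuous_sum fun i hi => ?_
  have hlsc := lowerSemicontinuous_variation_pair (ν := ν)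
    (SimpleFunc.measurableSet_preimage (SimpleFunc.eapprox (fun t => ‖f t‖ₑ) n) {i})
  have hi' : i ≠ ∞ := by
    obtain ⟨t, rfl⟩ := SimpleFunc.mem_range.1 hi
    exact (SimpleFunc.eapprox_lt_top _ _ _).ne
  exact (ENNReal.continuous_const_mul hi').comp_lowerSemicontinuous hlsc
    fun a b hab => mul_le_mul_right hab i

theorem IsWeaklyIntegrable.exists_bound (hf : ν.IsWeaklyIntegrable f) :
    ∃ C : ℝ≥0, ∀ x' : StrongDual ℂ X,
      ∫⁻ t, ‖f t‖ₑ ∂(ν.pair x').variation ≤ C * ‖x'‖ₑ := by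
  have hfin : ∀ x' : StrongDual ℂ X, ∫⁻ t, ‖f t‖ₑ ∂(ν.pair x').variation ≠ ∞ :=
    fun x' => (hf.2 x').2.ne
  let p : Seminorm ℂ (StrongDual ℂ X) := Seminorm.of
    (fun x' => (∫⁻ t, ‖f t‖ₑ ∂(ν.pair x').variation).toReal)
    (fun x' y' => by
      rw [← ENNReal.toReal_add (hfin _) (hfin _)]
      refine ENNReal.toReal_mono (ENNReal.add_ne_top.2 ⟨hfin _, hfin _⟩) ?_
      rw [← lintegral_add_measure]
      refine lintegral_mono' ?_ le_rfl
      rw [pair_add]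
      exact variation_add_le)
    (fun c x' => by
      simp only [pair_smul, variation_smul]
      rw [lintegral_smul_measure]
      rw [ENNReal.smul_def, smul_eq_mul, ENNReal.toReal_mul, ENNReal.coe_toReal, coe_nnnorm])
  have hp : LowerSemicontinuous p := by
    intro x' c hc
    have hc' : c < (∫⁻ t, ‖f t‖ₑ ∂(ν.pair x').variation).toReal := hc
    rcases lt_or_ge c 0 with h0 | h0
    · exact Eventually.of_forall fun y => h0.trans_le ENNReal.toReal_nonneg
    · have := lowerSemicontinuous_lintegral_pair (ν := ν) hf.1 x' (ENNReal.ofReal c)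
        ((ENNReal.ofReal_lt_iff_lt_toReal h0 (hfin _)).2 hc')
      filter_upwards [this] with y hy
      exact (ENNReal.ofReal_lt_iff_lt_toReal h0 (hfin _)).1 hy
  have hcont := Seminorm.continuous_of_lowerSemicontinuous p hp
  obtain ⟨C, hC, h⟩ := Seminorm.bound_of_continuous_normedSpace p hcont
  refine ⟨C.toNNReal, fun x' => ?_⟩
  have := h x'
  have h2 : (∫⁻ t, ‖f t‖ₑ ∂(ν.pair x').variation).toReal ≤ C * ‖x'‖ := this
  rw [← ENNReal.ofReal_toReal (hfin x')]
  refine (ENNReal.ofReal_le_ofReal h2).trans (le_of_eq ?_)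
  rw [ENNReal.ofReal_mul hC.le, ofReal_norm]
  rfl

theorem IsWeaklyIntegrable.eL1norm_ne_top (hf : ν.IsWeaklyIntegrable f) : ν.eL1norm f ≠ ∞ := by
  obtain ⟨C, hC⟩ := hf.exists_bound
  refine ne_top_of_le_ne_top (ENNReal.coe_ne_top (r := C)) (iSup₂_le fun x' hx' => ?_)
  have h1 : ‖x'‖ₑ ≤ 1 := by
    rw [← ofReal_norm]; exact ENNReal.ofReal_le_one.2 hx'
  exact (hC x').trans (mul_le_of_le_one_right zero_le h1)

theorem eL1norm_add_le (hf : Measurable f) : ν.eL1norm (f + g) ≤ ν.eL1norm f + ν.eL1norm g := by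
  refine iSup₂_le fun x' hx' => ?_
  calc ∫⁻ t, ‖(f + g) t‖ₑ ∂(ν.pair x').variation
      ≤ ∫⁻ t, (‖f t‖ₑ + ‖g t‖ₑ) ∂(ν.pair x').variation :=
        lintegral_mono fun t => enorm_add_le _ _
    _ = _ := lintegral_add_left hf.enorm _
    _ ≤ _ := add_le_add
        (le_iSup₂ (f := fun (y' : StrongDual ℂ X) (_ : y' ∈ {y' : StrongDual ℂ X | ‖y'‖ ≤ 1}) =>
          ∫⁻ t, ‖f t‖ₑ ∂(ν.pair y').variation) x' hx')
        (le_iSup₂ (f := fun (y' : StrongDual ℂ X) (_ : y' ∈ {y' : StrongDual ℂ X | ‖y'‖ ≤ 1}) =>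
          ∫⁻ t, ‖g t‖ₑ ∂(ν.pair y').variation) x' hx')

theorem eL1norm_smul (c : ℂ) : ν.eL1norm (c • f) = ‖c‖ₑ * ν.eL1norm f := by
  simp only [eL1norm, ENNReal.mul_iSup]
  refine iSup_congr fun x' => iSup_congr fun _ => ?_
  rw [← lintegral_const_mul' _ _ enorm_ne_top]
  simp only [Pi.smul_apply, enorm_smul]

variable (ν) in
/-- The submodule of `ν`-integrable functions inside all functions `Ω → ℂ`. -/
def integrableSubmodule : Submodule ℂ (Ω → ℂ) where
  carrier := {f | ν.IsIntegrable f}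
  zero_mem' := IsIntegrable.zero
  add_mem' hf hg := hf.add hg
  smul_mem' c _ hf := hf.smul c

variable (ν) in
/-- The vector space of `ν`-integrable functions. (A separate type, so that it does not carry the
topology of pointwise convergence.) -/
def IntegrableFun : Type _ := ν.integrableSubmodule

instance : AddCommGroup ν.IntegrableFun := inferInstanceAs (AddCommGroup ν.integrableSubmodule)

instance : Module ℂ ν.IntegrableFun := inferInstanceAs (Module ℂ ν.integrableSubmodule)

/-- The seminorm `‖f‖_ν = sup {∫ |f| d|⟨ν, x'⟩| | ‖x'‖ ≤ 1}`. -/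
noncomputable instance : Norm ν.IntegrableFun := ⟨fun f => (ν.eL1norm f.1).toReal⟩

theorem IntegrableFun.norm_def (f : ν.IntegrableFun) : ‖f‖ = (ν.eL1norm f.1).toReal := rfl

theorem IntegrableFun.core : SeminormedSpace.Core ℂ ν.IntegrableFun where
  norm_nonneg _ := ENNReal.toReal_nonneg
  norm_smul c f := by
    rw [IntegrableFun.norm_def, show (c • f).1 = c • f.1 from rfl, eL1norm_smul, ENNReal.toReal_mul,
      toReal_enorm, IntegrableFun.norm_def]
  norm_triangle f g := by
    have hf := f.2.1.eL1norm_ne_top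
    have hg := g.2.1.eL1norm_ne_top
    change (ν.eL1norm (f.1 + g.1)).toReal ≤ (ν.eL1norm f.1).toReal + (ν.eL1norm g.1).toReal
    rw [← ENNReal.toReal_add hf hg]
    exact ENNReal.toReal_mono (ENNReal.add_ne_top.2 ⟨hf, hg⟩) (eL1norm_add_le f.2.1.1)

noncomputable instance : SeminormedAddCommGroup ν.IntegrableFun :=
  SeminormedAddCommGroup.ofCore IntegrableFun.core

noncomputable instance : NormedSpace ℂ ν.IntegrableFun :=
  { norm_smul_le := fun c f => (IntegrableFun.core.norm_smul c f).le }

variable (ν) in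
/-- The normed space `L¹(ν)` of `ν`-integrable functions, with two functions identified when
`‖f - g‖_ν = 0`, i.e. when they agree outside a `ν`-null set. -/
abbrev L1 : Type _ := SeparationQuotient ν.IntegrableFun

/-- The class in `L¹(ν)` of a `ν`-integrable function. -/
noncomputable abbrev L1.mk (f : ν.IntegrableFun) : ν.L1 := SeparationQuotient.mk f

end MeasureTheory.VectorMeasure

end VectorMeasureL1

section Convolution

set_option linter.unusedSectionVars false

variable {G : Type*} [Group G] [TopologicalSpace G] [IsTopologicalGroup G] [CompactSpace G]
  [T2Space G] [MeasurableSpace G] [BorelSpace G]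

/-- The normalized Haar measure of a compact group. -/
noncomputable def haarProb (G : Type*) [Group G] [TopologicalSpace G] [IsTopologicalGroup G]
    [CompactSpace G] [MeasurableSpace G] [BorelSpace G] : Measure G :=
  Measure.haarMeasure ⊤

instance : IsProbabilityMeasure (haarProb G) :=
  ⟨by simpa [haarProb] using Measure.haarMeasure_self (K₀ := (⊤ : TopologicalSpace.PositiveCompacts G))⟩

/-- The convolution `(μ * f)(t) = ∫ f (s⁻¹ t) dμ(s)`. -/
noncomputable def convFun (μ : ComplexMeasure G) (f : G → ℂ) (t : G) : ℂ :=
  μ.integral (fun s => f (s⁻¹ * t)) (ContinuousLinearMap.mul ℝ ℂ)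

theorem measurableSet_transl {A : Set G} (hA : MeasurableSet A) (t : G) :
    MeasurableSet {s : G | s⁻¹ * t ∈ A} :=
  (Continuous.measurable (by fun_prop : Continuous fun s : G => s⁻¹ * t)) hA

theorem measurable_measure_transl {ρ lam : Measure G} [ρ.Regular] (h : lam ≤ ρ) {A : Set G}
    (hA : MeasurableSet A) : Measurable fun t => lam {s : G | s⁻¹ * t ∈ A} := by
  have : IsFiniteMeasure lam := isFiniteMeasure_of_le ρ h
  induction A, hA using MeasurableSpace.induction_on_inter
    (BorelSpace.measurable_eq (α := G)) isPiSystem_isOpen with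
  | empty => simp
  | basic U hU =>
    have hU : IsOpen U := hU
    refine LowerSemicontinuous.measurable fun t c hc => ?_
    have hVo : IsOpen {s : G | s⁻¹ * t ∈ U} :=
      hU.preimage (by fun_prop : Continuous fun s : G => s⁻¹ * t)
    obtain ⟨K, hKV, hK, hcK⟩ : ∃ K ⊆ {s : G | s⁻¹ * t ∈ U}, IsCompact K ∧ c < lam K := by
      have hε : lam {s : G | s⁻¹ * t ∈ U} - c ≠ 0 := (tsub_pos_of_lt hc).ne'
      obtain ⟨K, hKV, hK, hlt⟩ := hVo.measurableSet.exists_isCompact_sdiff_lt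
        (μ := ρ) (measure_ne_top _ _) hε
      refine ⟨K, hKV, hK, ?_⟩
      by_contra hle
      have h3 : lam {s : G | s⁻¹ * t ∈ U} < lam {s : G | s⁻¹ * t ∈ U} := by
        calc lam {s : G | s⁻¹ * t ∈ U} ≤ lam K + lam ({s : G | s⁻¹ * t ∈ U} \ K) := by
              refine (measure_mono ?_).trans (measure_union_le _ _)
              rw [union_sdiff_self]
              exact subset_union_right
          _ < c + (lam {s : G | s⁻¹ * t ∈ U} - c) :=
              ENNReal.add_lt_add_of_le_of_lt (measure_ne_top _ _) (not_lt.1 hle)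
                ((h _).trans_lt hlt)
          _ = lam {s : G | s⁻¹ * t ∈ U} := add_tsub_cancel_of_le hc.le
      exact lt_irrefl _ h3
    have : ∀ᶠ t' in 𝓝 t, ∀ s ∈ K, s⁻¹ * t' ∈ U := by
      refine hK.eventually_forall_of_forall_eventually fun s hs => ?_
      exact (by fun_prop : Continuous fun z : G × G => z.2⁻¹ * z.1).continuousAt.eventually
        (hU.mem_nhds (hKV hs))
    filter_upwards [this] with t' ht'
    exact hcK.trans_le (measure_mono ht')
  | compl A hA ih =>
    have : (fun t => lam {s : G | s⁻¹ * t ∈ Aᶜ}) =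
        fun t => lam univ - lam {s : G | s⁻¹ * t ∈ A} := by
      ext t
      exact measure_compl (measurableSet_transl hA t) (measure_ne_top _ _)
    rw [this]
    exact measurable_const.sub ih
  | iUnion f hd hm ih =>
    have : (fun t => lam {s : G | s⁻¹ * t ∈ ⋃ i, f i}) =
        fun t => ∑' i, lam {s : G | s⁻¹ * t ∈ f i} := by
      ext t
      rw [← measure_iUnion (fun i j hij => ?_) fun i => measurableSet_transl (hm i) t]
      · congr 1; ext s; simp
      · exact (hd hij).preimage (fun s : G => s⁻¹ * t)
    rw [this]
    exact Measurable.tsum ih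

theorem measurable_signed_transl {ρ : Measure G} [ρ.Regular] {σ : SignedMeasure G}
    (h : σ.variation ≤ ρ) {A : Set G} (hA : MeasurableSet A) :
    Measurable fun t => σ {s : G | s⁻¹ * t ∈ A} := by
  rw [← SignedMeasure.totalVariation_eq_variation] at h
  have h1 : σ.toJordanDecomposition.posPart ≤ ρ := (Measure.le_add_right le_rfl).trans h
  have h2 : σ.toJordanDecomposition.negPart ≤ ρ := (Measure.le_add_left le_rfl).trans h
  have : (fun t => σ {s : G | s⁻¹ * t ∈ A}) = fun t =>
      σ.toJordanDecomposition.posPart.real {s : G | s⁻¹ * t ∈ A} -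
        σ.toJordanDecomposition.negPart.real {s : G | s⁻¹ * t ∈ A} := by
    ext t
    exact σ.apply_eq_posPart_real_sub_negPart_real (measurableSet_transl hA t)
  rw [this]
  exact (measurable_measure_transl h1 hA).ennreal_toReal.sub
    (measurable_measure_transl h2 hA).ennreal_toReal

variable (μ : ComplexMeasure G) [μ.variation.Regular]

theorem measurable_complex_transl {A : Set G} (hA : MeasurableSet A) :
    Measurable fun t => μ {s : G | s⁻¹ * t ∈ A} := by
  have hre : (ComplexMeasure.re μ).variation ≤ μ.variation :=
    VectorMeasure.variation_le_of_forall_enorm_le fun E _ =>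
      le_trans (enorm_le_iff_norm_le.2 (Complex.abs_re_le_norm (μ E)))
        (VectorMeasure.enorm_measure_le_variation μ E)
  have him : (ComplexMeasure.im μ).variation ≤ μ.variation :=
    VectorMeasure.variation_le_of_forall_enorm_le fun E _ =>
      le_trans (enorm_le_iff_norm_le.2 (Complex.abs_im_le_norm (μ E)))
        (VectorMeasure.enorm_measure_le_variation μ E)
  have h1 := measurable_signed_transl hre hA
  have h2 := measurable_signed_transl him hA
  have : (fun t => μ {s : G | s⁻¹ * t ∈ A}) = fun t =>
      ((ComplexMeasure.re μ {s : G | s⁻¹ * t ∈ A} : ℝ) : ℂ) +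
        ((ComplexMeasure.im μ {s : G | s⁻¹ * t ∈ A} : ℝ) : ℂ) * Complex.I := by
    ext t
    exact (Complex.re_add_im _).symm
  rw [this]
  exact (Complex.measurable_ofReal.comp h1).add
    ((Complex.measurable_ofReal.comp h2).mul_const _)

theorem convFun_indicator {A : Set G} (hA : MeasurableSet A) (t : G) :
    convFun μ (A.indicator 1) t = μ {s : G | s⁻¹ * t ∈ A} := by
  have : (fun s : G => A.indicator (1 : G → ℂ) (s⁻¹ * t)) =
      {s : G | s⁻¹ * t ∈ A}.indicator fun _ => 1 := by
    ext s
    by_cases h : s⁻¹ * t ∈ A <;> simp [h]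
  have hm := measurableSet_transl hA t
  rw [convFun, this]
  refine (VectorMeasure.integral_indicator hm).trans ?_
  have : IsFiniteMeasure (μ.restrict {s : G | s⁻¹ * t ∈ A}).variation :=
    isFiniteMeasure_of_le (μ.variation.restrict _) VectorMeasure.variation_restrict_le
  rw [VectorMeasure.integral_const, VectorMeasure.restrict_apply _ hm MeasurableSet.univ]
  simp

theorem measurable_convFun_indicator {A : Set G} (hA : MeasurableSet A) :
    Measurable (convFun μ (A.indicator 1)) := by
  have : convFun μ (A.indicator 1) = fun t => μ {s : G | s⁻¹ * t ∈ A} :=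
    funext (convFun_indicator μ hA)
  rw [this]
  exact measurable_complex_transl μ hA

theorem enorm_convFun_indicator_le {A : Set G} (hA : MeasurableSet A) (t : G) :
    ‖convFun μ (A.indicator 1) t‖₊ ≤ (μ.variation univ).toNNReal := by
  rw [convFun_indicator μ hA, ← ENNReal.coe_le_coe, ENNReal.coe_toNNReal (measure_ne_top _ _)]
  exact (VectorMeasure.enorm_measure_le_variation μ _).trans (measure_mono (subset_univ _))

theorem mem_orliczSpace_of_bounded {α : Type*} {mα : MeasurableSpace α} {m : Measure α}
    [IsProbabilityMeasure m] (Φ : YoungFunction) (f : α →ₘ[m] ℂ) (C : ℝ≥0)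
    (h : ∀ᵐ x ∂m, ‖f x‖₊ ≤ C) : f ∈ OrliczSpace Φ m := by
  have hk : (0 : ℝ≥0) < 1 + Φ C := by positivity
  refine ⟨1 + Φ C, hk, ?_⟩
  have hΦ : Φ (C / (1 + Φ C)) ≤ 1 := by
    have h1 : (1 + Φ C)⁻¹ ≤ 1 := inv_le_one_of_one_le₀ (le_add_of_nonneg_right zero_le)
    have h2 := Φ.map_mul_le h1 C
    rw [← div_eq_inv_mul, ← div_eq_inv_mul] at h2
    exact h2.trans (div_le_one_of_le₀ (le_add_of_nonneg_left zero_le) zero_le)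
  calc orliczModular Φ m f (1 + Φ C) ≤ ∫⁻ _, 1 ∂m := by
        refine lintegral_mono_ae ?_
        filter_upwards [h] with x hx
        refine ENNReal.coe_le_one_iff.2 ((Φ.mono ?_).trans hΦ)
        gcongr
    _ = 1 := by simp

/-- The class of `μ * χ_A` in `L^Φ(G)`. -/
noncomputable def convIndicator (Φ : YoungFunction) {A : Set G} (hA : MeasurableSet A) :
    OrliczSpace Φ (haarProb G) :=
  ⟨AEEqFun.mk (convFun μ (A.indicator 1)) (measurable_convFun_indicator μ hA).aestronglyMeasurable,
    mem_orliczSpace_of_bounded Φ _ (μ.variation univ).toNNReal (by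
      filter_upwards [AEEqFun.coeFn_mk _
        (measurable_convFun_indicator μ hA).aestronglyMeasurable] with t ht
      rw [ht]
      exact enorm_convFun_indicator_le μ hA t)⟩

theorem coeFn_convIndicator (Φ : YoungFunction) {A : Set G} (hA : MeasurableSet A) :
    (convIndicator μ Φ hA).1 =ᵐ[haarProb G] fun t => μ {s : G | s⁻¹ * t ∈ A} := by
  refine (AEEqFun.coeFn_mk _ _).trans (Eventually.of_forall fun t => ?_)
  exact convFun_indicator μ hA t

theorem coeFn_sum_convIndicator (Φ : YoungFunction) {f : ℕ → Set G}
    (hf : ∀ i, MeasurableSet (f i)) (S : Finset ℕ) :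
    (∑ i ∈ S, convIndicator μ Φ (hf i)).1 =ᵐ[haarProb G]
      fun t => ∑ i ∈ S, μ {s : G | s⁻¹ * t ∈ f i} := by
  classical
  induction S using Finset.induction_on with
  | empty =>
    simpa using! AEEqFun.coeFn_zero (α := G) (β := ℂ) (μ := haarProb G)
  | insert i S hi ih =>
    rw [Finset.sum_insert hi]
    filter_upwards [AEEqFun.coeFn_add (convIndicator μ Φ (hf i)).1
      (∑ i ∈ S, convIndicator μ Φ (hf i)).1, coeFn_convIndicator μ Φ (hf i), ih] with t h1 h2 h3
    rw [Finset.sum_insert hi, ← h2, ← h3]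
    exact h1

theorem hasSum_convIndicator (Φ : YoungFunction) {f : ℕ → Set G}
    (hf : ∀ i, MeasurableSet (f i)) (hd : Pairwise (Function.onFun Disjoint f)) :
    HasSum (fun i => convIndicator μ Φ (hf i)) (convIndicator μ Φ (MeasurableSet.iUnion hf)) := by
  have hU := MeasurableSet.iUnion hf
  let C : ℝ≥0 := (μ.variation univ).toNNReal
  have hC : ∀ E, ‖μ E‖₊ ≤ C := fun E => by
    rw [← ENNReal.coe_le_coe, ENNReal.coe_toNNReal (measure_ne_top _ _)]
    exact (VectorMeasure.enorm_measure_le_variation μ _).trans (measure_mono (subset_univ _))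
  let h : Finset ℕ → G → ℂ := fun S t =>
    (∑ i ∈ S, μ {s : G | s⁻¹ * t ∈ f i}) - μ {s : G | s⁻¹ * t ∈ ⋃ i, f i}
  have hdt : ∀ t : G, Pairwise (Function.onFun Disjoint fun i => {s : G | s⁻¹ * t ∈ f i}) :=
    fun t i j hij => (hd hij).preimage (fun s : G => s⁻¹ * t)
  have hbd : ∀ S t, ‖h S t‖₊ ≤ C + C := fun S t => by
    refine (nnnorm_sub_le _ _).trans (add_le_add ?_ (hC _))
    rw [← VectorMeasure.of_biUnion_finset (fun i _ j _ hij => hdt t hij)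
      fun i _ => measurableSet_transl (hf i) t]
    exact hC _
  have hlim : ∀ t, Tendsto (fun S => h S t) atTop (𝓝 0) := fun t => by
    have h1 := VectorMeasure.hasSum_of_disjoint_iUnion (v := μ)
      (fun i => measurableSet_transl (hf i) t) (hdt t)
    have h2 : (⋃ i, {s : G | s⁻¹ * t ∈ f i}) = {s : G | s⁻¹ * t ∈ ⋃ i, f i} := by ext s; simp
    rw [h2] at h1
    have h3 := Tendsto.sub_const h1 (μ {s : G | s⁻¹ * t ∈ ⋃ i, f i})
    rw [sub_self, SummationFilter.unconditional_filter] at h3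
    exact h3
  have hhm : ∀ S, Measurable (h S) := fun S =>
    (Finset.measurable_fun_sum S fun i _ => measurable_complex_transl μ (hf i)).sub
      (measurable_complex_transl μ hU)
  have hmod : ∀ ε : ℝ≥0, 0 < ε →
      Tendsto (fun S => ∫⁻ t, (Φ (‖h S t‖₊ / ε) : ℝ≥0∞) ∂haarProb G) atTop (𝓝 0) := by
    intro ε hε
    have := tendsto_lintegral_filter_of_dominated_convergence (μ := haarProb G)
      (F := fun S t => (Φ (‖h S t‖₊ / ε) : ℝ≥0∞)) (f := fun _ => 0) (l := atTop)
      (fun _ => (Φ ((C + C) / ε) : ℝ≥0∞))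
      (Eventually.of_forall fun S =>
        (Φ.measurable.comp ((hhm S).nnnorm.div_const ε)).coe_nnreal_ennreal)
      (Eventually.of_forall fun S => Eventually.of_forall fun t =>
        ENNReal.coe_le_coe.2 (Φ.mono (by gcongr; exact hbd S t)))
      (by simp [ENNReal.coe_ne_top])
      (Eventually.of_forall fun t => by
        have h1 : Tendsto (fun S => ‖h S t‖₊ / ε) atTop (𝓝 0) := by
          simpa using! (hlim t).nnnorm.div_const ε
        rw [← ENNReal.coe_zero]
        exact ENNReal.tendsto_coe.2 (Φ.tendsto_zero.comp h1))
    simpa using this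
  refine tendsto_iff_norm_sub_tendsto_zero.2 ?_
  rw [Metric.tendsto_nhds]
  intro δ hδ
  let ε : ℝ≥0 := ⟨δ / 2, (half_pos hδ).le⟩
  have hε : 0 < ε := half_pos hδ
  filter_upwards [(hmod ε hε).eventually_le_const one_pos] with S hS
  have hle : luxemburg Φ (haarProb G) (∑ i ∈ S, convIndicator μ Φ (hf i) -
      convIndicator μ Φ hU : OrliczSpace Φ (haarProb G)).1 ≤ ε := by
    refine luxemburg_le hε (le_trans (le_of_eq (lintegral_congr_ae ?_)) hS)
    filter_upwards [AEEqFun.coeFn_sub (∑ i ∈ S, convIndicator μ Φ (hf i)).1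
      (convIndicator μ Φ hU).1, coeFn_sum_convIndicator μ Φ hf S,
      coeFn_convIndicator μ Φ hU] with t h1 h2 h3
    have h4 : (∑ i ∈ S, convIndicator μ Φ (hf i) -
      convIndicator μ Φ hU : OrliczSpace Φ (haarProb G)).1 t = h S t := by
      refine h1.trans ?_
      rw [Pi.sub_apply, h2, h3]
    rw [h4]
  rw [dist_zero_right, norm_norm]
  calc ‖∑ i ∈ S, convIndicator μ Φ (hf i) - convIndicator μ Φ hU‖ ≤ (ε : ℝ) :=
        NNReal.coe_le_coe.2 hle
    _ < δ := half_lt_self hδ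

/-- The vector measure `ν_{Φ,μ} : A ↦ μ * χ_A` with values in `L^Φ(G)`. -/
noncomputable def convVectorMeasure (Φ : YoungFunction) :
    VectorMeasure G (OrliczSpace Φ (haarProb G)) where
  measureOf' A := open Classical in if hA : MeasurableSet A then convIndicator μ Φ hA else 0
  empty' := by
    rw [dif_pos MeasurableSet.empty]
    refine Subtype.ext (AEEqFun.ext ?_)
    filter_upwards [coeFn_convIndicator μ Φ MeasurableSet.empty,
      AEEqFun.coeFn_zero (α := G) (β := ℂ) (μ := haarProb G)] with t h1 h2
    rw [h1, ZeroMemClass.coe_zero, h2]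
    simp
  not_measurable' A hA := dif_neg hA
  m_iUnion' f hf hd := by
    simp only [dif_pos (hf _), dif_pos (MeasurableSet.iUnion hf)]
    exact hasSum_convIndicator μ Φ hf hd

end Convolution

/-! Everything rests on one functional on `L^Φ(G)`: the mean `x₀' = ∫ · dm_G`. Jensen's inequality
applied to `|f| / k`, with `k` above the Luxemburg norm, shows `‖x₀'‖ ≤ Φ⁻¹(1)`. Invariance of Haar
measure gives `⟨ν, x₀'⟩(A) = ∫ μ * χ_A dm_G = μ(G) m_G(A)`, so `|⟨ν, x₀'⟩| ≥ |μ(G)| m_G`.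
Integrating `|f|` and rescaling `x₀'` into the unit ball yields `|μ(G)| ‖f‖₁ ≤ Φ⁻¹(1) ‖f‖_ν`
(`enorm_mul_lintegral_le_eL1norm`). This is the norm estimate; with `f = 1` it also shows `‖ν‖ > 0`.

Injectivity goes the opposite way: an `m_G`-null set `A` has `μ * χ_A = 0` almost everywhere, so
every `|⟨ν, x'⟩|` is absolutely continuous with respect to `m_G`, and a function vanishing
`m_G`-a.e. has `‖f‖_ν = 0`. The constant `1` has `‖1‖_ν = ‖ν‖` and `‖1‖₁ = 1`, which bounds the norm
of the inclusion from below. Indicators of Borel sets are `ν`-integrable, so the range is dense.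

Convolving on the left commutes with translating on the right: the right translation `R_t` of
`L^Φ(G)` satisfies `R_t ν(A) = ν(A t⁻¹)`. Hence `s ↦ s t` pushes `⟨ν, x'⟩` forward to `⟨ν, x' ∘
R_t⟩`, and `ν`-integrability of `f` passes to `f(· t)`. -/

namespace YoungFunction

/-! ### Young functions and Jensen's inequality -/

variable (Φ : YoungFunction)

/-- In `ℝ≥0` the `sSup` of an unbounded set is `0`; boundedness is what makes `Φ.inv a` a genuine
supremum. -/
theorem bddAbove_sublevel (a : ℝ≥0) : BddAbove {x | Φ x ≤ a} := by
  obtain ⟨b, hb⟩ := (Φ.tendsto_atTop'.eventually_gt_atTop a).exists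
  exact ⟨b, fun x hx => le_of_not_ge fun hbx => absurd (hb.trans_le (Φ.mono hbx)) hx.not_gt⟩

theorem le_inv {x a : ℝ≥0} (h : Φ x ≤ a) : x ≤ Φ.inv a :=
  le_csSup (Φ.bddAbove_sublevel a) h

theorem inv_pos {a : ℝ≥0} (ha : 0 < a) : 0 < Φ.inv a := by
  have h : ∀ᶠ x in 𝓝[>] (0 : ℝ≥0), Φ x ≤ a :=
    (Φ.tendsto_zero.mono_left nhdsWithin_le_nhds).eventually_le_const ha
  obtain ⟨x, hx, hx0⟩ := (h.and self_mem_nhdsWithin).exists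
  exact lt_of_lt_of_le hx0 (Φ.le_inv hx)

/-- A Young function dominates an affine function of positive slope. -/
theorem exists_le_add_mul : ∃ b : ℝ≥0, ∀ u, u ≤ b + b * Φ u := by
  -- Choose `b` with `Φ b ≥ 1`. Beyond `b`, convexity and `Φ 0 = 0` give `1 ≤ Φ b ≤ (b / u) Φ u`.
  obtain ⟨b, hb⟩ := ((Φ.tendsto_atTop'.eventually_ge_atTop 1).and (eventually_gt_atTop 0)).exists
  refine ⟨b, fun u => ?_⟩
  rcases le_total u b with h | h
  · exact h.trans (le_add_of_nonneg_right zero_le)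
  have hu : u ≠ 0 := (hb.2.trans_le h).ne'
  have h1 := Φ.map_mul_le (div_le_one_of_le₀ h zero_le : b / u ≤ 1) u
  rw [div_mul_cancel₀ b hu] at h1
  calc u = u * 1 := (mul_one u).symm
    _ ≤ u * (b / u * Φ u) := by gcongr; exact hb.1.trans h1
    _ = b * Φ u := by field_simp
    _ ≤ _ := le_add_of_nonneg_left zero_le

/-- The positive part is convex and `Φ` is convex and increasing. Extending `Φ` to all of `ℝ`, an
open set, also yields the continuity that Jensen's inequality asks for. -/
theorem convexOn_toNNReal : ConvexOn ℝ univ fun x : ℝ => (Φ x.toNNReal : ℝ) := by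
  refine ⟨convex_univ, fun x _ y _ a b ha hb hab => ?_⟩
  lift a to ℝ≥0 using ha
  lift b to ℝ≥0 using hb
  have h1 : (a • x + b • y : ℝ).toNNReal ≤ a • x.toNNReal + b • y.toNNReal := by
    refine Real.toNNReal_le_iff_le_coe.2 ?_
    simp only [NNReal.smul_def, smul_eq_mul, NNReal.coe_add, NNReal.coe_mul]
    gcongr <;> exact Real.le_coe_toNNReal _
  have h2 := Φ.convexOn'.2 (mem_univ x.toNNReal) (mem_univ y.toNNReal) (zero_le (a := a))
    (zero_le (a := b)) (by exact_mod_cast hab)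
  exact_mod_cast (Φ.mono h1).trans h2

/-- Jensen's inequality: `∫ u dm ≤ Φ⁻¹ 1` as soon as `∫ Φ(u) dm ≤ 1`. -/
theorem lintegral_le_inv {α : Type*} {mα : MeasurableSpace α} {m : Measure α}
    [IsProbabilityMeasure m] {u : α → ℝ≥0} (hu : AEMeasurable u m)
    (h : ∫⁻ x, (Φ (u x) : ℝ≥0∞) ∂m ≤ 1) : ∫⁻ x, (u x : ℝ≥0∞) ∂m ≤ Φ.inv 1 := by
  obtain ⟨b, hb⟩ := Φ.exists_le_add_mul
  have hΦm : AEMeasurable (fun x => Φ (u x)) m := Φ.measurable.comp_aemeasurable hu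
  -- Jensen's inequality needs `u` integrable; the affine bound on `u` in terms of `Φ u` supplies
  -- this.
  have hfin : ∫⁻ x, (u x : ℝ≥0∞) ∂m ≠ ∞ := by
    refine ne_top_of_le_ne_top (b := (b : ℝ≥0∞) + b * 1) (by finiteness) ?_
    calc ∫⁻ x, (u x : ℝ≥0∞) ∂m ≤ ∫⁻ x, ((b : ℝ≥0∞) + b * (Φ (u x) : ℝ≥0∞)) ∂m :=
          lintegral_mono fun x => by
            rw [← ENNReal.coe_mul, ← ENNReal.coe_add]
            exact ENNReal.coe_le_coe.2 (hb (u x))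
      _ = b + b * ∫⁻ x, (Φ (u x) : ℝ≥0∞) ∂m := by
          rw [lintegral_add_left measurable_const, lintegral_const, measure_univ, mul_one,
            lintegral_const_mul' _ _ ENNReal.coe_ne_top]
      _ ≤ _ := by gcongr
  have hΦfin : ∫⁻ x, (Φ (u x) : ℝ≥0∞) ∂m ≠ ∞ := ne_top_of_le_ne_top ENNReal.one_ne_top h
  have hui : Integrable (fun x => (u x : ℝ)) m :=
    ⟨hu.coe_nnreal_real.aestronglyMeasurable, by
      simpa [hasFiniteIntegral_iff_enorm, Real.enorm_eq_ofReal] using hfin.lt_top⟩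
  have hΦi : Integrable (fun x => (Φ (u x) : ℝ)) m :=
    ⟨hΦm.coe_nnreal_real.aestronglyMeasurable, by
      simpa [hasFiniteIntegral_iff_enorm, Real.enorm_eq_ofReal] using hΦfin.lt_top⟩
  have hJ := Φ.convexOn_toNNReal.map_integral_le (μ := m) (f := fun x => (u x : ℝ))
    (Φ.convexOn_toNNReal.continuousOn isOpen_univ) isClosed_univ (by simp) hui
    (by simpa [Function.comp_def] using hΦi)
  have h1 : (∫ x, (Φ (u x) : ℝ) ∂m) ≤ 1 := by
    rw [integral_eq_lintegral_of_nonneg_ae (Eventually.of_forall fun x => NNReal.coe_nonneg _)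
      hΦi.aestronglyMeasurable]
    simpa using ENNReal.toReal_mono ENNReal.one_ne_top h
  have h2 : (∫ x, (u x : ℝ) ∂m).toNNReal ≤ Φ.inv 1 := by
    refine Φ.le_inv ?_
    have := hJ.trans (by simpa using h1)
    exact_mod_cast this
  have h3 : ∫⁻ x, (u x : ℝ≥0∞) ∂m = ENNReal.ofReal (∫ x, (u x : ℝ) ∂m) := by
    rw [ofReal_integral_eq_lintegral_ofReal hui (Eventually.of_forall fun x => NNReal.coe_nonneg _)]
    simp
  rw [h3]
  exact ENNReal.coe_le_coe.2 h2

end YoungFunction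

/-! ### The mean functional and measure preserving maps on the Orlicz space -/

namespace OrliczSpace

variable {α : Type*} {mα : MeasurableSpace α} {Φ : YoungFunction} {m : Measure α}

section Probability

variable [IsProbabilityMeasure m]

theorem lintegral_enorm_le (f : OrliczSpace Φ m) :
    ∫⁻ x, ‖f.1 x‖ₑ ∂m ≤ Φ.inv 1 * luxemburg Φ m f.1 := by
  rw [← ENNReal.coe_mul]
  have key : ∀ k, luxemburg Φ m f.1 < k → ∫⁻ x, ‖f.1 x‖ₑ ∂m ≤ (Φ.inv 1 * k : ℝ≥0) := by
    intro k hk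
    have hk0 : k ≠ 0 := (zero_le.trans_lt hk).ne'
    have h1 := Φ.lintegral_le_inv (f.1.aestronglyMeasurable.aemeasurable.nnnorm.div_const k)
      (orliczModular_le_one_of_lt f.2 hk)
    calc ∫⁻ x, ‖f.1 x‖ₑ ∂m = ∫⁻ x, ((‖f.1 x‖₊ / k : ℝ≥0) : ℝ≥0∞) * k ∂m := by
          refine lintegral_congr fun x => ?_
          rw [← ENNReal.coe_mul, div_mul_cancel₀ _ hk0]; rfl
      _ = (∫⁻ x, ((‖f.1 x‖₊ / k : ℝ≥0) : ℝ≥0∞) ∂m) * k :=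
          lintegral_mul_const' _ _ ENNReal.coe_ne_top
      _ ≤ _ := by rw [ENNReal.coe_mul]; gcongr
  -- The modular is controlled only for `k` strictly above the Luxemburg norm, so the bound is
  -- obtained by letting `k` decrease to the norm.
  have hc : Tendsto (fun k : ℝ≥0 => ((Φ.inv 1 * k : ℝ≥0) : ℝ≥0∞)) (𝓝[>] (luxemburg Φ m f.1))
      (𝓝 ((Φ.inv 1 * luxemburg Φ m f.1 : ℝ≥0) : ℝ≥0∞)) :=
    (ENNReal.tendsto_coe.2 (tendsto_id.const_mul _)).mono_left nhdsWithin_le_nhds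
  exact ge_of_tendsto hc (eventually_mem_nhdsWithin.mono key)

theorem integrable_coeFn (f : OrliczSpace Φ m) : Integrable f.1 m :=
  ⟨f.1.aestronglyMeasurable, (lintegral_enorm_le f).trans_lt
    (ENNReal.mul_lt_top ENNReal.coe_lt_top ENNReal.coe_lt_top)⟩

variable (Φ m) in
/-- The functional `f ↦ ∫ f dm` on `L^Φ(m)`, `m` a probability measure. -/
noncomputable def integralCLM : StrongDual ℂ (OrliczSpace Φ m) :=
  LinearMap.mkContinuous
    { toFun := fun f => ∫ x, f.1 x ∂m
      map_add' := fun f g => by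
        rw [← integral_add (integrable_coeFn f) (integrable_coeFn g)]
        exact integral_congr_ae (AEEqFun.coeFn_add f.1 g.1)
      map_smul' := fun c f => by
        rw [RingHom.id_apply, ← integral_smul]
        exact integral_congr_ae (AEEqFun.coeFn_smul c f.1) }
    (Φ.inv 1) fun f => by
      have h := (enorm_integral_le_lintegral_enorm f.1).trans (lintegral_enorm_le f)
      rw [← ENNReal.coe_mul] at h
      exact_mod_cast (ENNReal.coe_le_coe.1 h : ‖∫ x, f.1 x ∂m‖₊ ≤ _)

theorem integralCLM_apply (f : OrliczSpace Φ m) : integralCLM Φ m f = ∫ x, f.1 x ∂m := rfl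

theorem norm_integralCLM_le : ‖integralCLM Φ m‖ ≤ Φ.inv 1 :=
  LinearMap.mkContinuous_norm_le _ (NNReal.coe_nonneg _) _

end Probability

section Composition

variable {T : α → α}

theorem orliczModular_compMeasurePreserving (hT : MeasurePreserving T m m) (f : α →ₘ[m] ℂ)
    (k : ℝ≥0) : orliczModular Φ m (f.compMeasurePreserving T hT) k = orliczModular Φ m f k := by
  have hm : AEMeasurable (fun x => (Φ (‖f x‖₊ / k) : ℝ≥0∞)) m :=
    (Φ.measurable.comp_aemeasurable
      (f.aestronglyMeasurable.aemeasurable.nnnorm.div_const k)).coe_nnreal_ennreal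
  calc orliczModular Φ m (f.compMeasurePreserving T hT) k
      = ∫⁻ x, (Φ (‖f (T x)‖₊ / k) : ℝ≥0∞) ∂m := by
        refine lintegral_congr_ae ?_
        filter_upwards [AEEqFun.coeFn_compMeasurePreserving f hT] with x hx
        rw [hx, Function.comp_apply]
    _ = ∫⁻ x, (Φ (‖f x‖₊ / k) : ℝ≥0∞) ∂(m.map T) :=
        (lintegral_map' (by rwa [hT.map_eq]) hT.aemeasurable).symm
    _ = _ := by rw [hT.map_eq]; rfl

variable (Φ) in
/-- Composition with a measure preserving transformation, on `L^Φ(m)`. -/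
noncomputable def compCLM (hT : MeasurePreserving T m m) :
    OrliczSpace Φ m →L[ℂ] OrliczSpace Φ m :=
  LinearMap.mkContinuous
    { toFun := fun f => ⟨f.1.compMeasurePreserving T hT, by
        obtain ⟨k, hk, h⟩ := f.2
        exact ⟨k, hk, by rwa [orliczModular_compMeasurePreserving]⟩⟩
      map_add' := fun f g => Subtype.ext <| by
        change (f.1 + g.1).compMeasurePreserving T hT =
          f.1.compMeasurePreserving T hT + g.1.compMeasurePreserving T hT
        exact AEEqFun.induction_on₂ f.1 g.1 fun f hf g hg => rfl
      map_smul' := fun c f => Subtype.ext <| by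
        change (c • f.1).compMeasurePreserving T hT = c • f.1.compMeasurePreserving T hT
        exact AEEqFun.induction_on f.1 fun f hf => rfl }
    1 fun f => by
      rw [one_mul, norm_def, norm_def]
      refine le_of_eq ?_
      change ((luxemburg Φ m (f.1.compMeasurePreserving T hT) : ℝ≥0) : ℝ) = _
      simp only [luxemburg, orliczModular_compMeasurePreserving]

theorem coeFn_compCLM (hT : MeasurePreserving T m m) (f : OrliczSpace Φ m) :
    (compCLM Φ hT f).1 =ᵐ[m] f.1 ∘ T :=
  AEEqFun.coeFn_compMeasurePreserving f.1 hT

end Composition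

end OrliczSpace

/-! ### Haar measure on a compact group and averages of translates -/

section HaarProb

variable {G : Type*} [Group G] [TopologicalSpace G] [IsTopologicalGroup G] [CompactSpace G]
  [MeasurableSpace G] [BorelSpace G]

instance : (haarProb G).IsHaarMeasure := by
  unfold haarProb; infer_instance

/-- On a compact group, a finite left invariant measure is a multiple of the normalized Haar
measure. -/
theorem eq_smul_haarProb_of_isMulLeftInvariant (η : Measure G) [IsFiniteMeasure η]
    [η.IsMulLeftInvariant] : η = η univ • haarProb G := by
  have h := Measure.isMulInvariant_eq_smul_of_compactSpace η (haarProb G)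
  have h1 : η univ = Measure.haarScalarFactor η (haarProb G) := by
    conv_lhs => rw [h]
    simp
  rw [h1]
  exact h

instance : (haarProb G).IsMulRightInvariant := by
  refine ⟨fun g => ?_⟩
  have := Measure.isFiniteMeasure_map (haarProb G) (· * g)
  have h := eq_smul_haarProb_of_isMulLeftInvariant ((haarProb G).map (· * g))
  rwa [Measure.map_apply (measurable_mul_const g) .univ, preimage_univ, measure_univ,
    one_smul] at h

instance : (haarProb G).IsInvInvariant := by
  refine ⟨?_⟩
  have : IsFiniteMeasure (haarProb G).inv := Measure.isFiniteMeasure_map _ _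
  have h := eq_smul_haarProb_of_isMulLeftInvariant (haarProb G).inv
  rwa [Measure.inv_apply, inv_univ, measure_univ, one_smul] at h

/-- On a compact group, a finite right invariant measure is a multiple of the normalized Haar
measure. -/
theorem eq_smul_haarProb_of_isMulRightInvariant (η : Measure G) [IsFiniteMeasure η]
    [η.IsMulRightInvariant] : η = η univ • haarProb G := by
  have : IsFiniteMeasure η.inv := Measure.isFiniteMeasure_map _ _
  have h := eq_smul_haarProb_of_isMulLeftInvariant η.inv
  rw [Measure.inv_apply, inv_univ] at h
  calc η = η.inv.inv := (Measure.inv_inv η).symm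
    _ = (η univ • haarProb G).inv := by rw [← h]
    _ = η univ • (haarProb G).inv := by rw [Measure.inv, Measure.map_smul]; rfl
    _ = _ := by rw [Measure.inv_eq_self]

theorem measurePreserving_mul_right_haarProb (t : G) :
    MeasurePreserving (· * t) (haarProb G) (haarProb G) :=
  measurePreserving_mul_right _ t

variable [T2Space G]

/-- The measure `A ↦ ∫ lam {s | s⁻¹ t ∈ A} dt`, that is `lam * m_G`, is `lam(G) m_G`. -/
theorem lintegral_measure_transl {ρ lam : Measure G} [ρ.Regular] [IsFiniteMeasure ρ] (h : lam ≤ ρ)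
    {A : Set G} (hA : MeasurableSet A) :
    ∫⁻ t, lam {s : G | s⁻¹ * t ∈ A} ∂haarProb G = lam univ * haarProb G A := by
  have hlam : IsFiniteMeasure lam := isFiniteMeasure_of_le ρ h
  -- Tonelli is avoided, since the Borel sets of `G × G` may exceed the product σ-algebra. Instead
  -- the left side is shown to be a right invariant measure in `A` of mass `lam univ`, and
  -- uniqueness of Haar measure identifies it.
  let η : Measure G := Measure.ofMeasurable
    (fun A _ => ∫⁻ t, lam {s : G | s⁻¹ * t ∈ A} ∂haarProb G) (by simp) fun f hf hd => by
      rw [← lintegral_tsum fun i => (measurable_measure_transl h (hf i)).aemeasurable]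
      refine lintegral_congr fun t => ?_
      rw [← measure_iUnion (fun i j hij => ?_) fun i => measurableSet_transl (hf i) t]
      · congr 1
        ext s
        simp
      · exact (hd hij).preimage (fun s : G => s⁻¹ * t)
  have hη : ∀ {A : Set G}, MeasurableSet A →
      η A = ∫⁻ t, lam {s : G | s⁻¹ * t ∈ A} ∂haarProb G := fun hA => Measure.ofMeasurable_apply _ hA
  have huniv : η univ = lam univ := by rw [hη .univ]; simp
  have : IsFiniteMeasure η := ⟨by rw [huniv]; exact measure_lt_top _ _⟩
  have : η.IsMulRightInvariant := by
    refine ⟨fun g => Measure.ext fun A hA => ?_⟩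
    have hgA := measurable_mul_const g hA
    rw [Measure.map_apply (measurable_mul_const g) hA, hη hgA, hη hA]
    rw [← lintegral_mul_right_eq_self (fun t => lam {s : G | s⁻¹ * t ∈ A}) g]
    refine lintegral_congr fun t => ?_
    congr 1
    ext s
    simp [mul_assoc]
  rw [← hη hA, eq_smul_haarProb_of_isMulRightInvariant η, huniv]
  rfl

/-- Both Jordan parts lie below the regular measure `ρ`, which is what the positive case requires;
subtract. -/
theorem integral_signed_transl {ρ : Measure G} [ρ.Regular] [IsFiniteMeasure ρ]
    {σ : SignedMeasure G} (h : σ.variation ≤ ρ) {A : Set G} (hA : MeasurableSet A) :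
    Integrable (fun t => σ {s : G | s⁻¹ * t ∈ A}) (haarProb G) ∧
      ∫ t, σ {s : G | s⁻¹ * t ∈ A} ∂haarProb G = σ univ * (haarProb G).real A := by
  rw [← SignedMeasure.totalVariation_eq_variation] at h
  have key : ∀ lam : Measure G, lam ≤ ρ →
      Integrable (fun t => lam.real {s : G | s⁻¹ * t ∈ A}) (haarProb G) ∧
        ∫ t, lam.real {s : G | s⁻¹ * t ∈ A} ∂haarProb G = lam.real univ * (haarProb G).real A := by
    intro lam hlam
    have : IsFiniteMeasure lam := isFiniteMeasure_of_le ρ hlam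
    have hm := measurable_measure_transl hlam hA
    have hl := lintegral_measure_transl hlam hA
    refine ⟨integrable_toReal_of_lintegral_ne_top hm.aemeasurable ?_, ?_⟩
    · rw [hl]; finiteness
    · simp only [Measure.real]
      rw [integral_toReal hm.aemeasurable (Eventually.of_forall fun t => measure_lt_top _ _), hl,
        ENNReal.toReal_mul]
  obtain ⟨i1, e1⟩ := key σ.toJordanDecomposition.posPart ((Measure.le_add_right le_rfl).trans h)
  obtain ⟨i2, e2⟩ := key σ.toJordanDecomposition.negPart ((Measure.le_add_left le_rfl).trans h)
  have hσ : (fun t => σ {s : G | s⁻¹ * t ∈ A}) = fun t =>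
      σ.toJordanDecomposition.posPart.real {s : G | s⁻¹ * t ∈ A} -
        σ.toJordanDecomposition.negPart.real {s : G | s⁻¹ * t ∈ A} := by
    ext t
    exact σ.apply_eq_posPart_real_sub_negPart_real (measurableSet_transl hA t)
  rw [hσ]
  refine ⟨i1.sub i2, ?_⟩
  rw [integral_sub i1 i2, e1, e2, σ.apply_eq_posPart_real_sub_negPart_real .univ, sub_mul]

variable (μ : ComplexMeasure G) [μ.variation.Regular]

theorem integral_complex_transl {A : Set G} (hA : MeasurableSet A) :
    ∫ t, μ {s : G | s⁻¹ * t ∈ A} ∂haarProb G = μ univ * ((haarProb G).real A : ℂ) := by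
  have hre : (ComplexMeasure.re μ).variation ≤ μ.variation :=
    VectorMeasure.variation_le_of_forall_enorm_le fun E _ =>
      le_trans (enorm_le_iff_norm_le.2 (Complex.abs_re_le_norm (μ E)))
        (VectorMeasure.enorm_measure_le_variation μ E)
  have him : (ComplexMeasure.im μ).variation ≤ μ.variation :=
    VectorMeasure.variation_le_of_forall_enorm_le fun E _ =>
      le_trans (enorm_le_iff_norm_le.2 (Complex.abs_im_le_norm (μ E)))
        (VectorMeasure.enorm_measure_le_variation μ E)
  obtain ⟨i1, e1⟩ := integral_signed_transl hre hA
  obtain ⟨i2, e2⟩ := integral_signed_transl him hA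
  have hμ : ∀ E, μ E = ((ComplexMeasure.re μ E : ℝ) : ℂ) +
      ((ComplexMeasure.im μ E : ℝ) : ℂ) * Complex.I := fun E => (Complex.re_add_im _).symm
  simp_rw [hμ]
  rw [integral_add i1.ofReal (i2.ofReal.mul_const _), integral_mul_const,
    integral_complex_ofReal, integral_complex_ofReal, e1, e2]
  push_cast
  ring

/-- The translates have mean `|μ|`-measure `|μ|(G) m_G(A) = 0`, and `|μ|` dominates `μ`. -/
theorem ae_measure_transl_eq_zero {A : Set G} (hA : MeasurableSet A) (h0 : haarProb G A = 0) :
    ∀ᵐ t ∂haarProb G, μ {s : G | s⁻¹ * t ∈ A} = 0 := by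
  have h := lintegral_measure_transl (le_refl μ.variation) hA
  rw [h0, mul_zero, lintegral_eq_zero_iff (measurable_measure_transl le_rfl hA)] at h
  filter_upwards [h] with t ht
  exact enorm_eq_zero.1 (nonpos_iff_eq_zero.1
    ((VectorMeasure.enorm_measure_le_variation μ _).trans ht.le))

end HaarProb

/-- The variation is at most the sum of those of the real and imaginary parts, finite by Jordan
decomposition. No regularity is assumed, so this covers the pairings `⟨ν, x'⟩` and makes constants
weakly `ν`-integrable. -/
instance isFiniteMeasure_variation_complexMeasure {Ω : Type*} {mΩ : MeasurableSpace Ω}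
    (ρ : ComplexMeasure Ω) : IsFiniteMeasure ρ.variation := by
  have hs : ∀ σ : SignedMeasure Ω, IsFiniteMeasure σ.variation := fun σ => by
    rw [← SignedMeasure.totalVariation_eq_variation]
    unfold SignedMeasure.totalVariation
    infer_instance
  have h1 := hs (ComplexMeasure.re ρ)
  have h2 := hs (ComplexMeasure.im ρ)
  refine isFiniteMeasure_of_le ((ComplexMeasure.re ρ).variation + (ComplexMeasure.im ρ).variation)
    (VectorMeasure.variation_le_of_forall_enorm_le fun E _ => ?_)
  have hE : ‖ρ E‖ₑ ≤ ‖ComplexMeasure.re ρ E‖ₑ + ‖ComplexMeasure.im ρ E‖ₑ := by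
    simp only [enorm_eq_nnnorm, ← ENNReal.coe_add]
    exact ENNReal.coe_le_coe.2 (Complex.norm_le_abs_re_add_abs_im (ρ E))
  exact hE.trans (add_le_add (VectorMeasure.enorm_measure_le_variation _ E)
    (VectorMeasure.enorm_measure_le_variation _ E))

/-! ### Null sets, indicators and scaling for a general vector measure -/

namespace MeasureTheory.VectorMeasure

section General

variable {Ω : Type*} {mΩ : MeasurableSpace Ω} {X : Type*} [NormedAddCommGroup X] [NormedSpace ℂ X]
  {ν : VectorMeasure Ω X} {f : Ω → ℂ}

theorem lintegral_pair_le_of_norm_le (x' : StrongDual ℂ X) {c : ℝ≥0} (hc : c ≠ 0) (h : ‖x'‖ ≤ c) :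
    ∫⁻ t, ‖f t‖ₑ ∂(ν.pair x').variation ≤ c * ν.eL1norm f := by
  let y' : StrongDual ℂ X := ((c⁻¹ : ℝ≥0) : ℂ) • x'
  have hy : ‖y'‖ ≤ 1 := by
    have hc0 : (0 : ℝ) < c := NNReal.coe_pos.2 (pos_iff_ne_zero.2 hc)
    rw [norm_smul]
    simpa [← div_eq_inv_mul] using div_le_one_of_le₀ h hc0.le
  have hx : x' = ((c : ℝ≥0) : ℂ) • y' := by
    rw [smul_smul]
    have hc' : ((c : ℝ) : ℂ) ≠ 0 := by exact_mod_cast hc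
    push_cast
    rw [mul_inv_cancel₀ hc', one_smul]
  have hn : ‖((c : ℝ) : ℂ)‖₊ = c := by ext; simp
  rw [hx, pair_smul, variation_smul, lintegral_smul_measure, hn, ENNReal.smul_def, smul_eq_mul]
  gcongr
  exact le_iSup₂ (f := fun (y' : StrongDual ℂ X) (_ : y' ∈ {y' : StrongDual ℂ X | ‖y'‖ ≤ 1}) =>
    ∫⁻ t, ‖f t‖ₑ ∂(ν.pair y').variation) y' hy

theorem eL1norm_eq_zero_of_ae {m : Measure Ω}
    (hm : ∀ x' : StrongDual ℂ X, (ν.pair x').variation ≪ m) (hf : f =ᵐ[m] 0) :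
    ν.eL1norm f = 0 := by
  refine nonpos_iff_eq_zero.1 (iSup₂_le fun x' _ => le_of_eq ?_)
  refine (lintegral_congr_ae ?_).trans lintegral_zero
  filter_upwards [(hm x').ae_le hf] with t ht
  simp [ht]

/-- The variation vanishes on `A` once the measure vanishes on each measurable subset of `A`, and
these subsets are `m`-null too. -/
theorem variation_pair_absolutelyContinuous {m : Measure Ω}
    (h : ∀ A, MeasurableSet A → m A = 0 → ν A = 0) (x' : StrongDual ℂ X) :
    (ν.pair x').variation ≪ m := by
  refine Measure.AbsolutelyContinuous.mk fun A hA h0 => ?_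
  refine (variation_apply_eq_zero hA).2 fun t ht htm => ?_
  rw [pair_apply, h t htm (measure_mono_null ht h0), ContinuousLinearMap.map_zero]

theorem eL1norm_one : ν.eL1norm 1 = ν.csemivariation univ := by
  simp [eL1norm, csemivariation]

theorem isIntegrable_indicator_const {B : Set Ω} (hB : MeasurableSet B) (c : ℂ) :
    ν.IsIntegrable (B.indicator fun _ => c) := by
  refine ⟨⟨measurable_const.indicator hB, fun x' => (integrable_const c).indicator hB⟩,
    fun A hA => existsUnique_of_exists (x := c • ν (B ∩ A)) fun x' => ?_⟩
  rw [integral_indicator hB, restrict_restrict _ hB hA, integral_const,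
    restrict_apply _ (hB.inter hA) MeasurableSet.univ, univ_inter, ContinuousLinearMap.map_smul]
  rfl

theorem isIntegrable_one : ν.IsIntegrable 1 := by
  simpa [← Pi.one_def] using isIntegrable_indicator_const (ν := ν) MeasurableSet.univ 1

end General

/-! ### The inclusion of `L¹(ν)` in `L¹(m)` -/

section Inclusion

variable {Ω : Type*} {mΩ : MeasurableSpace Ω} {X : Type*} [NormedAddCommGroup X] [NormedSpace ℂ X]
  {ν : VectorMeasure Ω X} {m : Measure Ω}

/-- The inclusion `L¹(ν) → L¹(m)`, when `‖f‖₁ ≤ C ‖f‖_ν`. -/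
noncomputable def L1.inclusion {C : ℝ}
    (h : ∀ f : ν.IntegrableFun, Integrable f.1 m ∧ ∫ t, ‖f.1 t‖ ∂m ≤ C * ‖f‖) :
    ν.L1 →L[ℂ] Lp ℂ 1 m :=
  SeparationQuotient.liftCLM
    (LinearMap.mkContinuous
      { toFun := fun f => (h f).1.toL1 f.1
        map_add' := fun f g => Integrable.toL1_add f.1 g.1 (h f).1 (h g).1
        map_smul' := fun c f => Integrable.toL1_smul' f.1 (h f).1 c } C fun f => by
          refine le_of_eq_of_le ?_ (h f).2
          exact (L1.norm_of_fun_eq_integral_norm (h f).1))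
    fun f g hfg => by
      -- Functions at `ν`-distance `0` have the same image because a bounded linear map is
      -- Lipschitz.
      refine dist_eq_zero.1 (le_antisymm ?_ dist_nonneg)
      refine (ContinuousLinearMap.lipschitz _).dist_le_mul f g |>.trans ?_
      rw [Metric.inseparable_iff.1 hfg, mul_zero]

variable {C : ℝ} (h : ∀ f : ν.IntegrableFun, Integrable f.1 m ∧ ∫ t, ‖f.1 t‖ ∂m ≤ C * ‖f‖)

theorem L1.coeFn_inclusion_mk (f : ν.IntegrableFun) :
    L1.inclusion h (L1.mk f) =ᵐ[m] f.1 := (h f).1.coeFn_toL1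

theorem L1.norm_inclusion_le (hC : 0 ≤ C) : ‖L1.inclusion h‖ ≤ C := by
  refine ContinuousLinearMap.opNorm_le_bound _ hC fun x => ?_
  obtain ⟨f, rfl⟩ := SeparationQuotient.surjective_mk x
  rw [SeparationQuotient.norm_mk]
  exact (le_of_eq (L1.norm_of_fun_eq_integral_norm (h f).1)).trans (h f).2

theorem L1.injective_inclusion (hm : ∀ x' : StrongDual ℂ X, (ν.pair x').variation ≪ m) :
    Function.Injective (L1.inclusion h) := by
  refine (injective_iff_map_eq_zero _).2 fun x hx => ?_
  obtain ⟨f, rfl⟩ := SeparationQuotient.surjective_mk x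
  rw [← norm_eq_zero, SeparationQuotient.norm_mk, IntegrableFun.norm_def,
    eL1norm_eq_zero_of_ae hm, ENNReal.toReal_zero]
  refine (L1.coeFn_inclusion_mk h f).symm.trans ?_
  rw [hx]
  exact Lp.coeFn_zero _ _ _

theorem L1.denseRange_inclusion : DenseRange (L1.inclusion h) := by
  intro g
  let S := (L1.inclusion h).range
  change g ∈ closure (range (L1.inclusion h))
  have hS : ∀ g : Lp ℂ 1 m, g ∈ S.topologicalClosure := by
    -- The closure of the range is a closed subspace, so it suffices that it contains multiples of
    -- indicators; these are already in the range.
    refine fun g => Lp.induction ENNReal.one_ne_top (motive := fun g => g ∈ S.topologicalClosure)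
      ?_ ?_ ?_ g
    · intro c B hB hBm
      refine S.le_topologicalClosure ⟨L1.mk ⟨_, isIntegrable_indicator_const hB c⟩, ?_⟩
      refine Lp.ext ((L1.coeFn_inclusion_mk h _).trans ?_)
      rw [Lp.simpleFunc.coe_indicatorConst]
      exact indicatorConstLp_coeFn.symm
    · intro f g hf hg _ hf' hg'
      exact S.topologicalClosure.add_mem hf' hg'
    · exact S.isClosed_topologicalClosure
  exact hS g

/-- Test the operator norm on the constant `1`, whose `L¹(m)` norm is `1` and whose `ν`-norm is the
total semivariation. -/
theorem L1.inv_csemivariation_le_norm_inclusion [IsProbabilityMeasure m] :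
    1 / (ν.csemivariation univ).toReal ≤ ‖L1.inclusion h‖ := by
  let e : ν.IntegrableFun := ⟨1, isIntegrable_one⟩
  have h1 := (L1.inclusion h).le_opNorm (L1.mk e)
  have h2 : ‖L1.inclusion h (L1.mk e)‖ = 1 := by
    refine (L1.norm_of_fun_eq_integral_norm (h e).1).trans ?_
    simp [e]
  rw [h2, SeparationQuotient.norm_mk, IntegrableFun.norm_def, eL1norm_one] at h1
  exact div_le_of_le_mul₀ ENNReal.toReal_nonneg (norm_nonneg _) h1

end Inclusion

end MeasureTheory.VectorMeasure

/-! ### The convolution measure: key inequality and right translations -/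

section ConvVectorMeasure

variable {G : Type*} [Group G] [TopologicalSpace G] [IsTopologicalGroup G] [CompactSpace G]
  [T2Space G] [MeasurableSpace G] [BorelSpace G] (μ : ComplexMeasure G) [μ.variation.Regular]
  (Φ : YoungFunction)

theorem convVectorMeasure_apply {A : Set G} (hA : MeasurableSet A) :
    convVectorMeasure μ Φ A = convIndicator μ Φ hA :=
  dif_pos hA

theorem coeFn_convVectorMeasure {A : Set G} (hA : MeasurableSet A) :
    (convVectorMeasure μ Φ A).1 =ᵐ[haarProb G] fun t => μ {s : G | s⁻¹ * t ∈ A} := by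
  rw [convVectorMeasure_apply μ Φ hA]
  exact coeFn_convIndicator μ Φ hA

theorem convVectorMeasure_eq_zero {A : Set G} (hA : MeasurableSet A) (h0 : haarProb G A = 0) :
    convVectorMeasure μ Φ A = 0 := by
  refine Subtype.ext (AEEqFun.ext ?_)
  filter_upwards [coeFn_convVectorMeasure μ Φ hA, ae_measure_transl_eq_zero μ hA h0,
    AEEqFun.coeFn_zero (α := G) (β := ℂ) (μ := haarProb G)] with t h1 h2 h3
  rw [h1, h2, ZeroMemClass.coe_zero, h3, Pi.zero_apply]

theorem integralCLM_convVectorMeasure {A : Set G} (hA : MeasurableSet A) :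
    OrliczSpace.integralCLM Φ (haarProb G) (convVectorMeasure μ Φ A) =
      μ univ * ((haarProb G).real A : ℂ) := by
  rw [OrliczSpace.integralCLM_apply, integral_congr_ae (coeFn_convVectorMeasure μ Φ hA),
    integral_complex_transl μ hA]

/-- Pairing with the mean gives exactly `μ(G) m_G`, and a variation dominates the absolute value of
its measure on each set. -/
theorem smul_haarProb_le_variation_pair :
    ‖μ univ‖₊ • haarProb G ≤ ((convVectorMeasure μ Φ).pair
      (OrliczSpace.integralCLM Φ (haarProb G))).variation := by
  refine Measure.le_intro fun A hA _ => ?_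
  refine le_of_eq_of_le ?_ (VectorMeasure.enorm_measure_le_variation _ A)
  rw [VectorMeasure.pair_apply, integralCLM_convVectorMeasure μ Φ hA, enorm_mul,
    Measure.smul_apply, ENNReal.smul_def, smul_eq_mul, ← enorm_eq_nnnorm]
  congr 1
  rw [← ofReal_norm, Complex.norm_real, Real.norm_of_nonneg measureReal_nonneg,
    ofReal_measureReal]

theorem enorm_mul_lintegral_le_eL1norm (f : G → ℂ) :
    ‖μ univ‖ₑ * ∫⁻ t, ‖f t‖ₑ ∂haarProb G ≤ Φ.inv 1 * (convVectorMeasure μ Φ).eL1norm f :=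
  calc ‖μ univ‖ₑ * ∫⁻ t, ‖f t‖ₑ ∂haarProb G = ∫⁻ t, ‖f t‖ₑ ∂(‖μ univ‖₊ • haarProb G) := by
        rw [lintegral_smul_measure, ENNReal.smul_def, smul_eq_mul, enorm_eq_nnnorm]
    _ ≤ _ := lintegral_mono' (smul_haarProb_le_variation_pair μ Φ) le_rfl
    _ ≤ _ := VectorMeasure.lintegral_pair_le_of_norm_le _ (Φ.inv_pos one_pos).ne'
        OrliczSpace.norm_integralCLM_le

theorem integrable_haarProb_of_integrableFun (hμ : μ univ ≠ 0)
    (f : (convVectorMeasure μ Φ).IntegrableFun) :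
    Integrable f.1 (haarProb G) ∧
      ∫ t, ‖f.1 t‖ ∂haarProb G ≤ (Φ.inv 1 : ℝ) / ‖μ univ‖ * ‖f‖ := by
  have h := enorm_mul_lintegral_le_eL1norm μ Φ f.1
  have htop : (Φ.inv 1 : ℝ≥0∞) * (convVectorMeasure μ Φ).eL1norm f.1 ≠ ∞ :=
    ENNReal.mul_ne_top ENNReal.coe_ne_top f.2.1.eL1norm_ne_top
  have hfin : ∫⁻ t, ‖f.1 t‖ₑ ∂haarProb G ≠ ∞ := by
    intro h'
    -- As `μ(G) ≠ 0`, an infinite integral of `|f|` would force `‖f‖_ν = ∞`.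
    rw [h', ENNReal.mul_top (enorm_ne_zero.2 hμ)] at h
    exact htop (top_le_iff.1 h)
  refine ⟨⟨f.2.1.1.aestronglyMeasurable, hfin.lt_top⟩, ?_⟩
  rw [integral_norm_eq_lintegral_enorm f.2.1.1.aestronglyMeasurable, div_mul_eq_mul_div,
    le_div_iff₀ (norm_pos_iff.2 hμ), VectorMeasure.IntegrableFun.norm_def, mul_comm]
  simpa [ENNReal.toReal_mul] using ENNReal.toReal_mono htop h

theorem csemivariation_convVectorMeasure_pos (hμ : μ univ ≠ 0) :
    0 < (convVectorMeasure μ Φ).csemivariation univ := by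
  have h := enorm_mul_lintegral_le_eL1norm μ Φ 1
  rw [VectorMeasure.eL1norm_one] at h
  refine pos_iff_ne_zero.2 fun h0 => hμ ?_
  simpa [h0] using h

/-- The semivariation is the `ν`-norm of the integrable function `1`, finite by the uniform bound
over functionals. -/
theorem csemivariation_convVectorMeasure_lt_top :
    (convVectorMeasure μ Φ).csemivariation univ < ∞ := by
  rw [← VectorMeasure.eL1norm_one]
  exact VectorMeasure.isIntegrable_one.1.eL1norm_ne_top.lt_top

/-- Right translation by `t` on `L^Φ(G)`. -/
noncomputable abbrev OrliczSpace.rightTranslate (t : G) :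
    OrliczSpace Φ (haarProb G) →L[ℂ] OrliczSpace Φ (haarProb G) :=
  OrliczSpace.compCLM Φ (measurePreserving_mul_right_haarProb t)

theorem rightTranslate_convVectorMeasure (t : G) {A : Set G} (hA : MeasurableSet A) :
    OrliczSpace.rightTranslate Φ t (convVectorMeasure μ Φ A) =
      convVectorMeasure μ Φ ((· * t) ⁻¹' A) := by
  refine Subtype.ext (AEEqFun.ext ?_)
  have hT := measurePreserving_mul_right_haarProb (G := G) t
  filter_upwards [OrliczSpace.coeFn_compCLM hT (convVectorMeasure μ Φ A),
    hT.quasiMeasurePreserving.ae_eq_comp (coeFn_convVectorMeasure μ Φ hA),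
    coeFn_convVectorMeasure μ Φ (measurable_mul_const t hA)] with s h1 h2 h3
  rw [h1, h2, h3]
  simp [mul_assoc]

/-- Moves a translation from the variable of integration to the functional, where integrability is
already known for all functionals. -/
theorem map_pair_convVectorMeasure (t : G) (x' : StrongDual ℂ (OrliczSpace Φ (haarProb G))) :
    ((convVectorMeasure μ Φ).pair x').map (· * t) =
      (convVectorMeasure μ Φ).pair (x'.comp (OrliczSpace.rightTranslate Φ t)) := by
  ext A hA
  rw [VectorMeasure.map_apply _ (measurable_mul_const t) hA, VectorMeasure.pair_apply,
    VectorMeasure.pair_apply, ContinuousLinearMap.comp_apply,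
    rightTranslate_convVectorMeasure μ Φ t hA]

theorem isIntegrable_comp_mul_right (t : G) {f : G → ℂ}
    (hf : (convVectorMeasure μ Φ).IsIntegrable f) :
    (convVectorMeasure μ Φ).IsIntegrable fun s => f (s * t) := by
  have hemb : MeasurableEmbedding (· * t : G → G) := measurableEmbedding_mulRight t
  refine ⟨⟨hf.1.1.comp (measurable_mul_const t), fun x' => ?_⟩, fun A hA => ?_⟩
  · have h := hf.1.2 (x'.comp (OrliczSpace.rightTranslate Φ t))
    rw [← map_pair_convVectorMeasure, hemb.variation_map] at h
    exact h.comp_measurable (measurable_mul_const t)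
  -- This set is `A t`. Integrating `f(· t)` over `A` against `x'` amounts to integrating `f` over
  -- `A t` against `x' ∘ R_t`, so the required vector is `R_t` of the integral of `f` over `A t`.
  have hA' : MeasurableSet ((· * t⁻¹) ⁻¹' A) := measurable_mul_const t⁻¹ hA
  have hpre : (· * t) ⁻¹' ((· * t⁻¹) ⁻¹' A) = A := by ext s; simp
  obtain ⟨x, hx, -⟩ := hf.2 _ hA'
  refine VectorMeasure.existsUnique_of_exists (x := OrliczSpace.rightTranslate Φ t x) fun x' => ?_
  have h := hx (x'.comp (OrliczSpace.rightTranslate Φ t))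
  rw [ContinuousLinearMap.comp_apply] at h
  rw [← h, ← map_pair_convVectorMeasure]
  have hres : (((convVectorMeasure μ Φ).pair x').map (· * t)).restrict ((· * t⁻¹) ⁻¹' A) =
      (((convVectorMeasure μ Φ).pair x').restrict A).map (· * t) := by
    ext E hE
    rw [VectorMeasure.restrict_apply _ hA' hE, VectorMeasure.map_apply _ hemb.measurable hE,
      VectorMeasure.map_apply _ hemb.measurable (hE.inter hA'),
      VectorMeasure.restrict_apply _ hA (hemb.measurable hE), preimage_inter, hpre]
  rw [hres]
  exact hemb.integral_map_vectorMeasure.symm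

end ConvVectorMeasure

/-! ### The main theorem -/

theorem mainTheorem8 {G : Type*} [Group G] [TopologicalSpace G] [IsTopologicalGroup G]
    [CompactSpace G] [T2Space G] [MeasurableSpace G] [BorelSpace G]
    (Φ : YoungFunction) (hΦ : Φ.DeltaTwo)
    (μ : ComplexMeasure G) [μ.variation.Regular] (hμ : μ univ ≠ 0) :
    -- every `ν`-integrable function is Haar integrable, with the norm estimate
    (∀ f : (convVectorMeasure μ Φ).IntegrableFun,
      Integrable f.1 (haarProb G) ∧
        ∫ t, ‖f.1 t‖ ∂haarProb G ≤ (Φ.inv 1 : ℝ) / ‖μ univ‖ * ‖f‖) ∧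
    0 < (convVectorMeasure μ Φ).csemivariation univ ∧
    (convVectorMeasure μ Φ).csemivariation univ < ∞ ∧
    -- the inclusion of `L¹(ν)` in `L¹(G)`
    ∃ j : (convVectorMeasure μ Φ).L1 →L[ℂ] Lp ℂ 1 (haarProb G),
      (∀ f : (convVectorMeasure μ Φ).IntegrableFun,
        j (VectorMeasure.L1.mk f) =ᵐ[haarProb G] f.1) ∧
      Function.Injective j ∧
      1 / ((convVectorMeasure μ Φ).csemivariation univ).toReal ≤ ‖j‖ ∧
      ‖j‖ ≤ (Φ.inv 1 : ℝ) / ‖μ univ‖ ∧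
      DenseRange j ∧
      ∀ t : G, ∀ g ∈ range j, ∃ h ∈ range j, h =ᵐ[haarProb G] fun s => g (s * t) := by
  have hi := integrable_haarProb_of_integrableFun μ Φ hμ
  refine ⟨hi, csemivariation_convVectorMeasure_pos μ Φ hμ,
    csemivariation_convVectorMeasure_lt_top μ Φ, VectorMeasure.L1.inclusion hi,
    VectorMeasure.L1.coeFn_inclusion_mk hi,
    VectorMeasure.L1.injective_inclusion hi (VectorMeasure.variation_pair_absolutelyContinuous
      fun A hA h0 => convVectorMeasure_eq_zero μ Φ hA h0),
    VectorMeasure.L1.inv_csemivariation_le_norm_inclusion hi,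
    VectorMeasure.L1.norm_inclusion_le hi (by positivity),
    VectorMeasure.L1.denseRange_inclusion hi, ?_⟩
  rintro t _ ⟨x, rfl⟩
  obtain ⟨f, rfl⟩ := SeparationQuotient.surjective_mk x
  refine ⟨_, ⟨VectorMeasure.L1.mk ⟨_, isIntegrable_comp_mul_right μ Φ t f.2⟩, rfl⟩, ?_⟩
  refine (VectorMeasure.L1.coeFn_inclusion_mk hi _).trans ?_
  exact ((measurePreserving_mul_right_haarProb t).quasiMeasurePreserving.ae_eq_comp
    (VectorMeasure.L1.coeFn_inclusion_mk hi f)).symm
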